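/- Let $\mathfrak X_0$ be an integral normal scheme with function field $K_0$, let $K$ be an algebraic closure of $K_0$, let $\mathfrak X$ be the normalization of $\mathfrak X_0$ in $K$, and let $G=\mathrm{Aut}(K/K_0)$. Let $\dot{\mathfrak X}(\mathbb C)$ be the set of pairs $(x,P)$ with $x\in\mathfrak X$ and $P:\kappa(x)^\times\to\mathbb C^\times$ a homomorphism. It carries the topology of pointwise convergence: the coarsest topology such that $(x,P)\mapsto x$ is continuous and such that for every open $U\subseteq\mathfrak X$ and every $f\in\Gamma(U,\mathcal O)$ the function $(x,P)\mapsto P(f(x))$ (read as $0$ if $f(x)=0$) is continuous on the pairs with $x\in U$. The group $G$ acts by $(x,P)^\sigma=(x^\sigma,P\circ\sigma)$, and the multiplicative monoid $\mathcal N$ of positive integers acts by $F_\nu(x,P)=(x,P\circ(\ )^\nu)$. Let $\mathcal E_{\mathrm{tors}}$ be the condition on $(x,P)$ that the restriction of $P$ to the roots of unity $\mu(\kappa(x))$ has finite kernel. Call a condition $\mathcal E$ on pairs $(x,P)$ admissible if it is $G$-invariant, if $F_\nu(x,P)$ satisfies it exactly when $(x,P)$ does (for all $\nu\ge 1$), and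 if it implies $\mathcal E_{\mathrm{tors}}$. For such $\mathcal E$ (for example $\mathcal E=\mathcal E_{\mathrm{tors}}$) let $\dot{\mathfrak X}_0(\mathbb C)_{\mathcal E}$ be the quotient by $G$ of the space of pairs satisfying $\mathcal E$, let $\check{\mathfrak X}_0(\mathbb C)_{\mathcal E}$ be the colimit of the copies $Y_a=\dot{\mathfrak X}_0(\mathbb C)_{\mathcal E}$, $a\in\mathcal N$ (ordered by divisibility), along the maps $F_m:Y_a\to Y_{am}$, and let $$X_{0\mathcal E}=\check{\mathfrak X}_0(\mathbb C)_{\mathcal E}\times_{\mathbb Q^{>0}}\mathbb R^{>0}$$ be the quotient by the diagonal action of $\mathbb Q^{>0}$, where $m\in\mathcal N$ acts on the colimit via $F_m$. Write $X_0=X_{0\mathcal E_{\mathrm{tors}}}$. For $n=0$ or $n$ prime let $\dot{\mathfrak X}_0(\mathbb C)_{\mathcal E,n,\mathrm{in}}$ be the quotient by $G$ of the space of the pairs $(x,P)$ that satisfy $\mathcal E$, with $\mathrm{char}\,\kappa(x)=n$ and $P|_{\mu(\kappa(x))}$ injective (for $\mathcal E=\mathcal E_{\mathrm{tors}}$ the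 condition $\mathcal E$ is then automatic); write $\mathbb Q$ instead of $n=0$. All quotients and colimits carry the quotient resp. colimit topology. 1. For every admissible condition $\mathcal E$, in particular for $\mathcal E_{\mathrm{tors}}$: for every prime $p$ the map $F_p$ is a homeomorphism of $\dot{\mathfrak X}_0(\mathbb C)_{\mathcal E,p,\mathrm{in}}$ onto itself, so that $p^{\mathbb Z}$ acts on this space with $p$ acting as $F_p$; and the canonical map $$\dot{\mathfrak X}_0(\mathbb C)_{\mathcal E,\mathbb Q,\mathrm{in}}\times\mathbb R^{>0}\ \amalg\ \coprod_p\dot{\mathfrak X}_0(\mathbb C)_{\mathcal E,p,\mathrm{in}}\times_{p^{\mathbb Z}}\mathbb R^{>0}\longrightarrow X_{0\mathcal E},\qquad [P,u]\mapsto[P,u],$$ is a continuous bijection, and it is equivariant for the flows $\phi^t[P,u]=[P,e^tu]$, $t\in\mathbb R$. 2. If $\mathfrak X_0$ is moreover flat and of finite type over $\mathrm{spec}\,\mathbb Z$, then for $\mathcal E=\mathcal E_{\mathrm{tors}}$ this map (with target $X_0$) is not a homeomorphism. -/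

import Mathlib

noncomputable section

namespace ArithDyn

open AlgebraicGeometry CategoryTheory

universe u

/-! ## Complex characters on the points of a scheme -/

/-- Pairs `(x, P)` of a point `x` of the scheme `X` and a character `P : κ(x)ˣ → ℂˣ`. -/
@[ext]
structure CPoint (X : Scheme.{u}) : Type u where
  /-- the point `x` -/
  pt : X
  /-- the multiplicative character of the residue field -/
  char : (X.residueField pt)ˣ →* ℂˣ

namespace CPoint

variable {X Y Z : Scheme.{u}}

open scoped Classical in
/-- The value at `(x, P)` of a section `f` defined near `x`: it is `P (f(x))` if `f(x) ≠ 0` in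
`κ(x)`, and `0` if `f(x) = 0`. -/
def value (z : CPoint X) (U : X.Opens) (hz : z.pt ∈ U) (f : Γ(X, U)) : ℂ :=
  if h : X.evaluation U z.pt hz f = 0 then 0
  else ((z.char (Units.mk0 (X.evaluation U z.pt hz f) h) : ℂˣ) : ℂ)

/-- The topology of pointwise convergence: the coarsest one for which `(x, P) ↦ x` is continuous
and for which every section of `X` over an open `U` has a continuous value function on the
pairs over `U`. Over an affine open `Spec R` the pairs are multiplicative maps `R → ℂ`, and this
is the topology of pointwise convergence of these maps. -/
instance : TopologicalSpace (CPoint X) :=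
  TopologicalSpace.generateFrom
    {W | ∃ (U : X.Opens) (f : Γ(X, U)) (V : Set ℂ), IsOpen V ∧
      W = {z : CPoint X | ∃ hz : z.pt ∈ U, z.value U hz f ∈ V}}

/-- The monoid of positive integers acts by `F_ν (x, P) = (x, P ∘ (·)^ν)`. -/
instance : MulAction ℕ+ (CPoint X) where
  smul ν z := ⟨z.pt, z.char.comp (powMonoidHom (ν : ℕ))⟩
  one_smul z := by
    change CPoint.mk _ _ = _
    congr 1
    ext a
    simp
  mul_smul μ ν z := by
    change CPoint.mk _ _ = CPoint.mk z.pt _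
    congr 1
    refine MonoidHom.ext fun a => congrArg z.char ?_
    change a ^ ((μ * ν : ℕ+) : ℕ) = (a ^ (μ : ℕ)) ^ (ν : ℕ)
    rw [PNat.mul_coe, pow_mul]

lemma smul_pt (ν : ℕ+) (z : CPoint X) : (ν • z).pt = z.pt := rfl

lemma smul_char (ν : ℕ+) (z : CPoint X) :
    (ν • z).char = z.char.comp (powMonoidHom (ν : ℕ)) := rfl

/-- A morphism `a : X ⟶ Y` maps `(x, P)` to `(a x, P ∘ a^*)` with `a^* : κ(a x) → κ(x)`. -/
def push (a : X ⟶ Y) (z : CPoint X) : CPoint Y :=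
  ⟨a z.pt, z.char.comp (Units.map (a.residueFieldMap z.pt).hom.toMonoidHom)⟩

lemma push_id (z : CPoint X) : push (𝟙 X) z = z := by
  change CPoint.mk z.pt _ = CPoint.mk z.pt _
  congr 1
  refine MonoidHom.ext fun (a : (X.residueField z.pt)ˣ) => congrArg z.char (Units.ext ?_)
  exact congrArg (fun g : X.residueField z.pt ⟶ X.residueField z.pt =>
    g.hom (a : X.residueField z.pt)) (Scheme.residueFieldMap_id z.pt)

lemma push_comp (a : X ⟶ Y) (b : Y ⟶ Z) (z : CPoint X) :
    push (a ≫ b) z = push b (push a z) := by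
  change CPoint.mk (b (a z.pt)) _ = CPoint.mk (b (a z.pt)) _
  congr 1
  ext u
  simp [push]
  rfl

lemma push_smul (a : X ⟶ Y) (ν : ℕ+) (z : CPoint X) : push a (ν • z) = ν • push a z := by
  change CPoint.mk (a z.pt) _ = CPoint.mk (a z.pt) _
  congr 1
  refine MonoidHom.ext fun u => congrArg z.char ?_
  exact (map_pow (Units.map (a.residueFieldMap z.pt).hom.toMonoidHom) u (ν : ℕ)).symm

/-- The condition on `(x, P)` that `P` has finite kernel on the roots of unity of `κ(x)`. -/
def torsionFinite (X : Scheme.{u}) : Set (CPoint X) :=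
  {z | {a : (X.residueField z.pt)ˣ | IsOfFinOrder a ∧ z.char a = 1}.Finite}

/-- The condition on `(x, P)` that `P` is injective on the roots of unity of `κ(x)`. -/
def torsionInjective (X : Scheme.{u}) : Set (CPoint X) :=
  {z | Set.InjOn z.char {a | IsOfFinOrder a}}

/-- The pairs `(x, P)` with `x` over the point `(n)` of `Spec ℤ`, for `n = 0` or `n` prime, that is
with `κ(x)` of characteristic `n`. -/
def fibre (X : Scheme.{u}) (n : ℕ) : Set (CPoint X) :=
  {z | CharP (X.residueField z.pt) n}

lemma torsionInjective_subset_torsionFinite (X : Scheme.{u}) :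
    torsionInjective X ⊆ torsionFinite X := by
  intro z hz
  refine (Set.finite_singleton 1).subset ?_
  rintro a ⟨ha, h1⟩
  exact hz ha IsOfFinOrder.one (by rw [h1, map_one])

lemma smul_mem_torsionFinite_iff (ν : ℕ+) (z : CPoint X) :
    ν • z ∈ torsionFinite X ↔ z ∈ torsionFinite X := by
  constructor
  · intro h
    refine Set.Finite.subset h ?_
    rintro a ⟨ha, h1⟩
    refine ⟨ha, ?_⟩
    change z.char (a ^ (ν : ℕ)) = 1
    rw [map_pow, h1, one_pow]
  · intro h
    classical
    have key : ∀ b : (X.residueField z.pt)ˣ, {a | a ^ (ν : ℕ) = b}.Finite := by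
      intro b
      have h2 : {c : X.residueField z.pt | c ^ (ν : ℕ) = (b : X.residueField z.pt)}.Finite := by
        refine ((Polynomial.nthRoots (ν : ℕ)
          (b : X.residueField z.pt)).toFinset.finite_toSet).subset ?_
        intro c hc
        simpa [Polynomial.mem_nthRoots ν.pos] using hc
      refine Set.Finite.of_finite_image (f := Units.val) (h2.subset ?_)
        Units.val_injective.injOn
      rintro _ ⟨a, ha, rfl⟩
      exact congrArg Units.val ha
    refine (Set.Finite.preimage' h (f := fun a => a ^ (ν : ℕ)) fun b _ => key b).subset ?_
    rintro a ⟨ha, h1⟩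
    exact ⟨IsOfFinOrder.pow ha, h1⟩

end CPoint

/-! ## The normalization in an algebraic closure and its Galois action -/

section Galois

variable (𝔛₀ : Scheme.{u}) [IsIntegral 𝔛₀] (K : Type u) [Field K] [Algebra 𝔛₀.functionField K]

/-- The morphism `Spec K ⟶ 𝔛₀` given by an extension `K` of the function field of `𝔛₀`. -/
def geomPoint : Spec (.of K) ⟶ 𝔛₀ :=
  Spec.map (CommRingCat.ofHom (algebraMap 𝔛₀.functionField K)) ≫
    𝔛₀.fromSpecStalk (genericPoint 𝔛₀)

instance : QuasiCompact (geomPoint 𝔛₀ K) where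
  isCompact_preimage _ _ _ := Set.Subsingleton.isCompact Set.subsingleton_of_subsingleton

/-- The normalization of `𝔛₀` in the extension `K` of its function field. -/
abbrev normalizationIn : Scheme.{u} := (geomPoint 𝔛₀ K).normalization

variable {𝔛₀ K}

lemma specMap_geomPoint (σ : K ≃ₐ[𝔛₀.functionField] K) :
    Spec.map (CommRingCat.ofHom (σ : K →+* K)) ≫ geomPoint 𝔛₀ K = geomPoint 𝔛₀ K := by
  unfold geomPoint
  rw [← Category.assoc, ← Spec.map_comp]
  congr 2
  ext a
  simp

/-- The endomorphism of the normalization over `𝔛₀` that is given on functions by `σ`. -/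
def galHom (σ : K ≃ₐ[𝔛₀.functionField] K) : normalizationIn 𝔛₀ K ⟶ normalizationIn 𝔛₀ K :=
  (geomPoint 𝔛₀ K).normalizationDesc
    (Spec.map (CommRingCat.ofHom (σ : K →+* K)) ≫ (geomPoint 𝔛₀ K).toNormalization)
    (geomPoint 𝔛₀ K).fromNormalization
    (by rw [Category.assoc, Scheme.Hom.toNormalization_fromNormalization, specMap_geomPoint])

lemma galHom_one : galHom (1 : K ≃ₐ[𝔛₀.functionField] K) = 𝟙 _ := by
  refine Scheme.Hom.normalization.hom_ext _ _ _ (geomPoint 𝔛₀ K).fromNormalization ?_ ?_ ?_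
  · rw [galHom, Scheme.Hom.toNormalization_normalizationDesc, Category.comp_id]
    have : CommRingCat.ofHom ((1 : K ≃ₐ[𝔛₀.functionField] K) : K →+* K) = 𝟙 _ := rfl
    rw [this, Spec.map_id, Category.id_comp]
  · simp [galHom]
  · simp

lemma galHom_mul (σ τ : K ≃ₐ[𝔛₀.functionField] K) :
    galHom (σ * τ) = galHom σ ≫ galHom τ := by
  refine Scheme.Hom.normalization.hom_ext _ _ _ (geomPoint 𝔛₀ K).fromNormalization ?_ ?_ ?_
  · rw [galHom, Scheme.Hom.toNormalization_normalizationDesc, galHom,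
      Scheme.Hom.toNormalization_normalizationDesc_assoc, Category.assoc, galHom,
      Scheme.Hom.toNormalization_normalizationDesc, ← Category.assoc, ← Spec.map_comp]
    rfl
  · simp [galHom]
  · simp [galHom]

/-- The Galois group `G = Aut(K / K₀)` acts on the pairs `(x, P)`. In the notation
`(x, P)^σ = (x^σ, P ∘ σ)` for the right action, `σ • (x, P) = (x, P)^(σ⁻¹)`. -/
instance : MulAction (K ≃ₐ[𝔛₀.functionField] K) (CPoint (normalizationIn 𝔛₀ K)) where
  smul σ z := z.push (galHom σ⁻¹)
  one_smul z := by
    change z.push (galHom 1⁻¹) = z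
    rw [inv_one, galHom_one, CPoint.push_id]
  mul_smul σ τ z := by
    change z.push (galHom (σ * τ)⁻¹) = (z.push (galHom τ⁻¹)).push (galHom σ⁻¹)
    rw [mul_inv_rev, galHom_mul, CPoint.push_comp]

lemma gal_smul_def (σ : K ≃ₐ[𝔛₀.functionField] K) (z : CPoint (normalizationIn 𝔛₀ K)) :
    σ • z = z.push (galHom σ⁻¹) := rfl

lemma gal_smul_comm (σ : K ≃ₐ[𝔛₀.functionField] K) (ν : ℕ+)
    (z : CPoint (normalizationIn 𝔛₀ K)) : σ • ν • z = ν • σ • z :=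
  CPoint.push_smul _ _ _

/-- `𝔛₀(ℂ)_S = S / G` for a `G`-stable set `S` of pairs, with the quotient topology. -/
def GalQuot (S : Set (CPoint (normalizationIn 𝔛₀ K))) : Type u :=
  Quotient ((MulAction.orbitRel (K ≃ₐ[𝔛₀.functionField] K)
    (CPoint (normalizationIn 𝔛₀ K))).comap (Subtype.val : S → _))

instance (S : Set (CPoint (normalizationIn 𝔛₀ K))) : TopologicalSpace (GalQuot S) :=
  inferInstanceAs (TopologicalSpace (Quotient _))

namespace GalQuot

variable {S T : Set (CPoint (normalizationIn 𝔛₀ K))}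

/-- The map `F_ν : S / G → T / G`, if `F_ν` maps `S` into `T`. -/
def frob (ν : ℕ+) (h : ∀ z ∈ S, ν • z ∈ T) : GalQuot S → GalQuot T :=
  Quotient.map' (fun z => ⟨ν • z.1, h z.1 z.2⟩) (by
    rintro ⟨z, hz⟩ ⟨w, hw⟩ ⟨σ, hσ⟩
    refine ⟨σ, ?_⟩
    change σ • ν • w = ν • z
    rw [gal_smul_comm]
    exact congrArg (ν • ·) hσ)

/-- The map `S / G → T / G` induced by an inclusion. -/
def incl (h : S ⊆ T) : GalQuot S → GalQuot T :=
  Quotient.map' (fun z => ⟨z.1, h z.2⟩) (fun _ _ hzw => hzw)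

end GalQuot

variable (𝔛₀ K)

/-- A condition on pairs `(x, P)` that is invariant under `G` and under the `F_ν`. -/
structure CharCondition where
  /-- the set of pairs with the property -/
  carrier : Set (CPoint (normalizationIn 𝔛₀ K))
  gal_mem : ∀ (σ : K ≃ₐ[𝔛₀.functionField] K), ∀ z ∈ carrier, σ • z ∈ carrier
  frob_mem_iff : ∀ (ν : ℕ+) (z : CPoint (normalizationIn 𝔛₀ K)), ν • z ∈ carrier ↔ z ∈ carrier

/-- The condition that `P` has finite kernel on the roots of unity of `κ(x)`. -/
def torsCondition : CharCondition 𝔛₀ K where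
  carrier := CPoint.torsionFinite _
  gal_mem σ z hz := by
    refine Set.Finite.of_finite_image
      (f := Units.map ((galHom σ⁻¹).residueFieldMap z.pt).hom.toMonoidHom)
      (Set.Finite.subset hz ?_) (Units.map_injective (RingHom.injective _)).injOn
    rintro _ ⟨a, ⟨ha, h1⟩, rfl⟩
    exact ⟨MonoidHom.isOfFinOrder _ ha, h1⟩
  frob_mem_iff := CPoint.smul_mem_torsionFinite_iff

variable {𝔛₀ K}

instance (E : CharCondition 𝔛₀ K) : MulAction ℕ+ (GalQuot E.carrier) where
  smul ν := GalQuot.frob ν fun z hz => (E.frob_mem_iff ν z).2 hz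
  one_smul := by
    rintro ⟨z, hz⟩
    exact congrArg (Quotient.mk _) (Subtype.ext (one_smul ℕ+ z))
  mul_smul μ ν := by
    rintro ⟨z, hz⟩
    exact congrArg (Quotient.mk _) (Subtype.ext (mul_smul μ ν z))

end Galois

/-! ## The colimit over the Frobenius maps and the suspension -/

/-- The multiplicative group of positive rational numbers. -/
abbrev PosRat : Type := {q : ℚ // 0 < q}

/-- The positive real numbers. -/
abbrev PosReal : Type := {u : ℝ // 0 < u}

/-- Positive rational numbers act on positive real numbers by multiplication. -/
instance : MulAction PosRat PosReal where
  smul q u := ⟨((q : ℚ) : ℝ) * u, mul_pos (by exact_mod_cast q.2) u.2⟩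
  one_smul u := Subtype.ext (by
    change (((1 : PosRat) : ℚ) : ℝ) * (u : ℝ) = u
    simp)
  mul_smul q r u := Subtype.ext (by
    change (((q * r : PosRat) : ℚ) : ℝ) * (u : ℝ) = ((q : ℚ) : ℝ) * (((r : ℚ) : ℝ) * (u : ℝ))
    simp [mul_assoc])

/-- The numerator of a positive rational number. -/
def PosRat.num (q : PosRat) : ℕ+ :=
  ⟨q.1.num.toNat, by have := Rat.num_pos.2 q.2; omega⟩

/-- The denominator of a positive rational number. -/
def PosRat.den (q : PosRat) : ℕ+ := ⟨q.1.den, q.1.den_pos⟩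

lemma PosRat.num_div_den (q : PosRat) : ((q.num : ℕ) : ℚ) / ((q.den : ℕ) : ℚ) = q := by
  have h : ((q.1.num.toNat : ℕ) : ℤ) = q.1.num := Int.toNat_of_nonneg (Rat.num_pos.2 q.2).le
  have h2 : ((q.1.num.toNat : ℕ) : ℚ) = (q.1.num : ℚ) := by exact_mod_cast h
  change ((q.1.num.toNat : ℕ) : ℚ) / ((q.1.den : ℕ) : ℚ) = q.1
  rw [h2, Rat.num_div_den]

lemma PosRat.num_mul_den (q r : PosRat) :
    (q * r).num * (q.den * r.den) = q.num * r.num * (q * r).den := by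
  have h1 := q.num_div_den
  have h2 := r.num_div_den
  have h3 := (q * r).num_div_den
  have e : ((q * r : PosRat) : ℚ) = (q : ℚ) * (r : ℚ) := rfl
  have p1 : ((q.den : ℕ) : ℚ) ≠ 0 := by simp
  have p2 : ((r.den : ℕ) : ℚ) ≠ 0 := by simp
  have p3 : (((q * r).den : ℕ) : ℚ) ≠ 0 := by simp
  rw [e, ← h1, ← h2, div_mul_div_comm, div_eq_div_iff p3 (mul_ne_zero p1 p2)] at h3
  apply PNat.coe_injective
  exact_mod_cast h3

section Colim

variable (Y : Type u) [MulAction ℕ+ Y]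

/-- The relation that defines the colimit of the copies `Y_a = Y`, `a ∈ ℕ+`, along the maps
`F_m : Y_a → Y_{am}`. -/
def frobSetoid : Setoid (Σ _ : ℕ+, Y) where
  r s t := ∃ c : ℕ+, (c * t.1) • s.2 = (c * s.1) • t.2
  iseqv :=
    { refl := fun _ => ⟨1, rfl⟩
      symm := fun ⟨c, h⟩ => ⟨c, h.symm⟩
      trans := by
        rintro ⟨a, P⟩ ⟨b, Q⟩ ⟨e, R⟩ ⟨c, h⟩ ⟨d, h'⟩
        refine ⟨c * d * b, ?_⟩
        dsimp only at h h' ⊢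
        calc (c * d * b * e) • P = (d * e) • (c * b) • P := by
              rw [← mul_smul]; congr 1; ring
          _ = (c * a) • (d * e) • Q := by rw [h, ← mul_smul, ← mul_smul, mul_comm]
          _ = (c * d * b * a) • R := by rw [h', ← mul_smul]; congr 1; ring }

/-- The colimit `colim_{ℕ+} Y` over `ℕ+` ordered by divisibility, with transition maps
`F_m : Y_a → Y_{am}`. -/
def FrobColim : Type u := Quotient (frobSetoid Y)

/-- The colimit topology, where each copy `Y_a` carries the topology of `Y`. -/
instance [TopologicalSpace Y] : TopologicalSpace (FrobColim Y) :=
  inferInstanceAs (TopologicalSpace (Quotient (frobSetoid Y)))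

variable {Y}

/-- The canonical map of the copy `Y_a` to the colimit. -/
def FrobColim.mk (a : ℕ+) (P : Y) : FrobColim Y := Quotient.mk (frobSetoid Y) ⟨a, P⟩

lemma FrobColim.mk_eq_mk_iff {a b : ℕ+} {P Q : Y} :
    FrobColim.mk a P = FrobColim.mk b Q ↔ ∃ c : ℕ+, (c * b) • P = (c * a) • Q :=
  Quotient.eq (r := frobSetoid Y)

/-- The positive rational number `m / n` maps the class of `P ∈ Y_a` to the class of
`F_m P ∈ Y_{na}`; so `m` acts as `F_m`, and `1 / n` as its inverse. -/
instance : MulAction PosRat (FrobColim Y) where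
  smul q := Quotient.map' (fun s => ⟨q.den * s.1, q.num • s.2⟩) (by
    rintro ⟨a, P⟩ ⟨b, Q⟩ ⟨c, h⟩
    refine ⟨c, ?_⟩
    dsimp only at h ⊢
    calc (c * (q.den * b)) • q.num • P = (q.den * q.num) • (c * b) • P := by
          rw [← mul_smul, ← mul_smul]; congr 1; ring
      _ = (c * (q.den * a)) • q.num • Q := by
          rw [h, ← mul_smul, ← mul_smul]; congr 1; ring)
  one_smul := by
    rintro ⟨a, P⟩
    refine FrobColim.mk_eq_mk_iff.2 ⟨1, ?_⟩
    have h1 : (1 : PosRat).den = 1 := rfl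
    have h2 : (1 : PosRat).num = 1 := rfl
    rw [h1, h2, one_smul, one_mul, one_mul]
  mul_smul q r := by
    rintro ⟨a, P⟩
    refine FrobColim.mk_eq_mk_iff.2 ⟨1, ?_⟩
    dsimp only
    rw [← mul_smul, ← mul_smul, ← mul_smul]
    congr 1
    have h := PosRat.num_mul_den q r
    calc 1 * (q.den * (r.den * a)) * (q * r).num
        = (q * r).num * (q.den * r.den) * a := by ring
      _ = 1 * ((q * r).den * a) * (q.num * r.num) := by rw [h]; ring
      _ = _ := by ring

lemma FrobColim.smul_mk (q : PosRat) (a : ℕ+) (P : Y) :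
    q • FrobColim.mk a P = FrobColim.mk (q.den * a) (q.num • P) := rfl

variable (Y)

/-- The suspension `(colim_{ℕ+} Y) ×_{ℚ^{>0}} ℝ^{>0}`: the quotient of the product by the diagonal
action of the positive rational numbers, with the quotient topology. -/
abbrev Suspension : Type u := MulAction.orbitRel.Quotient PosRat (FrobColim Y × PosReal)

variable {Y}

/-- Multiplication of a positive real number by `e^t`. -/
def expMul (t : ℝ) (u : PosReal) : PosReal := ⟨Real.exp t * u, mul_pos (Real.exp_pos t) u.2⟩

/-- The flow `φ^t [P, u] = [P, e^t u]`. -/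
def Suspension.flow (t : ℝ) : Suspension Y → Suspension Y :=
  Quotient.map' (fun s => (s.1, expMul t s.2)) (by
    rintro ⟨P, u⟩ ⟨Q, v⟩ ⟨q, h⟩
    refine ⟨q, ?_⟩
    obtain ⟨h1, h2⟩ := Prod.ext_iff.1 h
    refine Prod.ext h1 (Subtype.ext ?_)
    have h3 : ((q : ℚ) : ℝ) * (v : ℝ) = u := congrArg Subtype.val h2
    change ((q : ℚ) : ℝ) * (Real.exp t * (v : ℝ)) = Real.exp t * (u : ℝ)
    rw [← h3]
    ring)

end Colim

/-! ## The mapping torus of a single Frobenius -/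

section Torus

variable {Y : Type u} (F : Y → Y) (p : ℕ+)

/-- The equivalence relation on `Y × ℝ^{>0}` that is generated by `(y, u) ∼ (F y, p u)`. If `F` is
bijective, its classes are the orbits of `p^ℤ`, where `p` acts diagonally via `F` and via
multiplication by `p`. -/
def torusSetoid : Setoid (Y × PosReal) where
  r s t := ∃ m n : ℕ, F^[m] s.1 = F^[n] t.1 ∧
    ((p : ℕ) : ℝ) ^ m * (s.2 : ℝ) = ((p : ℕ) : ℝ) ^ n * (t.2 : ℝ)
  iseqv :=
    { refl := fun _ => ⟨0, 0, rfl, rfl⟩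
      symm := fun ⟨m, n, h, h'⟩ => ⟨n, m, h.symm, h'.symm⟩
      trans := by
        rintro ⟨y, u⟩ ⟨z, v⟩ ⟨w, x⟩ ⟨m, n, h1, h2⟩ ⟨k, l, h3, h4⟩
        dsimp only at h1 h2 h3 h4
        refine ⟨k + m, n + l, ?_, ?_⟩
        · dsimp only
          rw [Function.iterate_add_apply, h1, ← Function.iterate_add_apply, add_comm k n,
            Function.iterate_add_apply, h3, ← Function.iterate_add_apply]
        · dsimp only
          rw [pow_add, mul_assoc, h2, mul_left_comm, h4, pow_add, mul_assoc] }

/-- `Y ×_{p^ℤ} ℝ^{>0}`, with the quotient topology. -/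
def Torus : Type u := Quotient (torusSetoid F p)

instance [TopologicalSpace Y] : TopologicalSpace (Torus F p) :=
  inferInstanceAs (TopologicalSpace (Quotient (torusSetoid F p)))

variable {F p}

/-- The flow `φ^t [y, u] = [y, e^t u]`. -/
def Torus.flow (t : ℝ) : Torus F p → Torus F p :=
  Quotient.map' (fun s => (s.1, expMul t s.2)) (by
    rintro ⟨y, u⟩ ⟨z, v⟩ ⟨m, n, h1, h2⟩
    refine ⟨m, n, h1, ?_⟩
    change _ * (Real.exp t * (u : ℝ)) = _ * (Real.exp t * (v : ℝ))
    rw [mul_left_comm, h2, mul_left_comm])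

end Torus

/-! ## The source, the target, and the canonical map -/

section Main

variable {𝔛₀ : Scheme.{u}} [IsIntegral 𝔛₀] {K : Type u} [Field K] [Algebra 𝔛₀.functionField K]

namespace CharCondition

variable (E : CharCondition 𝔛₀ K)

/-- The pairs `(x, P)` that satisfy the condition, with `x` over the point `(n)` of `Spec ℤ` and
`P` injective on the roots of unity of `κ(x)`. -/
def piece (n : ℕ) : Set (CPoint (normalizationIn 𝔛₀ K)) :=
  E.carrier ∩ (CPoint.torsionInjective _ ∩ CPoint.fibre _ n)

lemma piece_subset (n : ℕ) : E.piece n ⊆ E.carrier := Set.inter_subset_left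

lemma frob_mem_piece (p : Nat.Primes) (z) (hz : z ∈ E.piece p) :
    (p : ℕ+) • z ∈ E.piece p := by
  obtain ⟨h1, h2, h3⟩ := hz
  refine ⟨(E.frob_mem_iff _ _).2 h1, ?_, h3⟩
  intro a ha b hb hab
  have h4 : a ^ (p : ℕ) = b ^ (p : ℕ) := h2 (IsOfFinOrder.pow ha) (IsOfFinOrder.pow hb) hab
  have : Fact (p : ℕ).Prime := ⟨p.2⟩
  have : CharP ((normalizationIn 𝔛₀ K).residueField z.pt) (p : ℕ) := h3
  refine Units.ext (frobenius_inj ((normalizationIn 𝔛₀ K).residueField z.pt) (p : ℕ) ?_)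
  exact congrArg Units.val h4

/-- The Frobenius `F_p` of `𝔛₀(ℂ)_{p, in}`. -/
def frobPiece (p : Nat.Primes) : GalQuot (E.piece p) → GalQuot (E.piece p) :=
  GalQuot.frob (p : ℕ+) (E.frob_mem_piece p)

/-- The disjoint union of `𝔛₀(ℂ)_{ℚ, in} × ℝ^{>0}` and of the spaces
`𝔛₀(ℂ)_{p, in} ×_{p^ℤ} ℝ^{>0}` over all primes `p`. -/
abbrev Source : Type u :=
  (GalQuot (E.piece 0) × PosReal) ⊕ (Σ p : Nat.Primes, Torus (E.frobPiece p) (p : ℕ+))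

/-- The dynamical system `(colim_{ℕ+} 𝔛₀(ℂ)_E) ×_{ℚ^{>0}} ℝ^{>0}`. -/
abbrev Target : Type u := Suspension (GalQuot E.carrier)

/-- The flow on the source, `[P, u] ↦ [P, e^t u]` on each part. -/
def sourceFlow (t : ℝ) : E.Source → E.Source :=
  Sum.map (fun s => (s.1, expMul t s.2)) (Sigma.map id fun _ => Torus.flow t)

/-- The point `[P, u]` of the target, for `P` in one of the pieces of `𝔛₀(ℂ)`. -/
def toTarget (n : ℕ) (s : GalQuot (E.piece n) × PosReal) : E.Target :=
  Quotient.mk'' (FrobColim.mk 1 (GalQuot.incl (E.piece_subset n) s.1), s.2)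

lemma incl_frobPiece (p : Nat.Primes) (P : GalQuot (E.piece p)) :
    GalQuot.incl (E.piece_subset p) (E.frobPiece p P) =
      (p : ℕ+) • GalQuot.incl (E.piece_subset p) P := by
  obtain ⟨z⟩ := P
  rfl

lemma toTarget_frob (p : Nat.Primes) (P : GalQuot (E.piece p)) (u v : PosReal) (m : ℕ)
    (h : (v : ℝ) = ((p : ℕ) : ℝ) ^ m * (u : ℝ)) :
    E.toTarget p ((E.frobPiece p)^[m] P, v) = E.toTarget p (P, u) := by
  have hp : (0 : ℚ) < ((p : ℕ) : ℚ) ^ m := pow_pos (by exact_mod_cast p.2.pos) m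
  refine Quotient.sound' ⟨⟨((p : ℕ) : ℚ) ^ m, hp⟩, Prod.ext ?_ (Subtype.ext ?_)⟩
  · have hI : ∀ k : ℕ, GalQuot.incl (E.piece_subset p) ((E.frobPiece p)^[k] P) =
        (p : ℕ+) ^ k • GalQuot.incl (E.piece_subset p) P := by
      intro k
      induction k with
      | zero => simp
      | succ k ih => rw [Function.iterate_succ_apply', incl_frobPiece, ih, pow_succ', mul_smul]
    dsimp only [Prod.smul_fst]
    rw [FrobColim.smul_mk, FrobColim.mk_eq_mk_iff, hI]
    refine ⟨1, ?_⟩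
    have hd : PosRat.den ⟨((p : ℕ) : ℚ) ^ m, hp⟩ = 1 := by
      apply PNat.coe_injective
      change (((p : ℕ) : ℚ) ^ m).den = 1
      rw [← Nat.cast_pow, Rat.den_natCast]
    have hn : PosRat.num ⟨((p : ℕ) : ℚ) ^ m, hp⟩ = (p : ℕ+) ^ m := by
      apply PNat.coe_injective
      change (((p : ℕ) : ℚ) ^ m).num.toNat = (((p : ℕ+) ^ m : ℕ+) : ℕ)
      rw [← Nat.cast_pow, Rat.num_natCast, Int.toNat_natCast, PNat.pow_coe]
      rfl
    rw [hd, hn]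
    simp
  · change ((((p : ℕ) : ℚ) ^ m : ℚ) : ℝ) * (u : ℝ) = v
    rw [h]
    push_cast
    rfl

/-- The canonical map `[P, u] ↦ [P, u]` from the source to the target. -/
def canonicalMap : E.Source → E.Target :=
  Sum.elim (E.toTarget 0) fun s => Quotient.lift (E.toTarget s.1) (by
    obtain ⟨p, -⟩ := s
    rintro ⟨P, u⟩ ⟨Q, v⟩ ⟨m, n, h1, h2⟩
    dsimp only at h1 h2
    have hp : (0 : ℝ) < ((p : ℕ) : ℝ) := by exact_mod_cast p.2.pos
    have e1 := E.toTarget_frob p P u ⟨((p : ℕ) : ℝ) ^ m * (u : ℝ),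
      mul_pos (pow_pos hp m) u.2⟩ m rfl
    have e2 := E.toTarget_frob p Q v ⟨((p : ℕ) : ℝ) ^ m * (u : ℝ),
      mul_pos (pow_pos hp m) u.2⟩ n h2
    rw [← e1, ← e2, h1]) s.2

/-- The condition is admissible: it implies that `P` has finite kernel on the roots of unity.
(Often one requires in addition that `P` has non-torsion image if `κ(x)` has positive characteristic
and `κ(x)ˣ` is not torsion; all conditions with this extra property are included here.) -/
def IsAdmissible : Prop := E.carrier ⊆ CPoint.torsionFinite _

end CharCondition

/-- For the torsion condition the pieces consist of all pairs `(x, P)` with `x` over `(n)` and `P`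
injective on the roots of unity. -/
lemma torsCondition_piece (n : ℕ) :
    (torsCondition 𝔛₀ K).piece n = CPoint.torsionInjective _ ∩ CPoint.fibre _ n :=
  Set.inter_eq_right.2 fun _ hz => CPoint.torsionInjective_subset_torsionFinite _ hz.1

end Main

end ArithDyn

end

namespace ArithDyn

open AlgebraicGeometry CategoryTheory

universe u

/-! Locally the normalization is an integral closure in an algebraically closed field, so monic
polynomials of positive degree over its stalks have roots (`absIntClosed_stalk`). Hence its residue
fields are algebraically closed and its functions have `ν`-th roots locally. The first fact makes
every `F_ν` injective, with each character trivial on `ν`-torsion in the image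
(`CPoint.exists_smul_eq`); the second makes `F_ν` a topological embedding
(`CPoint.isInducing_smul`). In characteristic `p` there is no `p`-torsion in the units, so `F_p` is
a homeomorphism on the `p`-part, and this descends to the Galois quotient.

Bijectivity is a matter of roots of unity. A finite subgroup of order `n` of the units of a field is
all of `μ_n`. So a character `P` with finite kernel on torsion is trivial on `μ_n` for a suitable
`n`, hence is `F_n` of a character that is injective on torsion; this gives surjectivity.
Conversely, if `F_k z = F_l w` with both characters injective on torsion, then `μ_k = μ_l` in the
residue field. In characteristic zero this means `k = l`; in characteristic `p` it means equality up
to powers of `p`, which is the ambiguity removed by the action of `p^ℤ`.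

The inverse fails to be continuous because pairs in characteristic zero converge to pairs in
characteristic `p`. A codimension-one point of residue characteristic `p` gives a discrete valuation
ring, which is dominated by a valuation ring `V` of `K` with a center on the normalization. Take a
torsion-injective character of the residue field of `V`, pull it back to the units of `V` and extend
it to `ρ` on `Kˣ`. This `ρ` kills all `p`-power roots of unity, but a twist by a character trivial
on a prescribed finite set makes the torsion kernel finite (`exists_twist`). Multiplying by powers
of a character that is trivial on units and contracts the maximal ideal
(`exists_contracting_character`) forces the correct limit zero there. So the image of the `p`-part
of the source is not open. -/

/-! ### Rings in which monic polynomials have roots -/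

/-- A commutative ring in which every monic polynomial of nonzero degree has a root. -/
def AbsIntClosed (R : Type*) [CommRing R] : Prop :=
  ∀ f : Polynomial R, f.Monic → f.natDegree ≠ 0 → ∃ x, f.IsRoot x

namespace AbsIntClosed

open Polynomial

lemma of_isAlgClosed (K : Type*) [Field K] [IsAlgClosed K] : AbsIntClosed K := fun f _ hd =>
  IsAlgClosed.exists_root f fun h => hd (natDegree_eq_of_degree_eq_some h)

lemma of_surjective {R S : Type*} [CommRing R] [CommRing S] (hR : AbsIntClosed R) (φ : R →+* S)
    (hφ : Function.Surjective φ) : AbsIntClosed S := by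
  intro f hf hd
  obtain ⟨g, rfl, hg, hgm⟩ := lifts_and_natDegree_eq_and_monic
    ((lifts_iff_coeff_lifts (f := φ) f).2 fun n => hφ _) hf
  obtain ⟨x, hx⟩ := hR g hgm (hg ▸ hd)
  exact ⟨φ x, hx.map⟩

lemma integralClosure {R L : Type*} [CommRing R] [CommRing L] [Algebra R L]
    (hL : AbsIntClosed L) : AbsIntClosed (integralClosure R L) := by
  intro f hf hd
  nontriviality L
  obtain ⟨x, hx⟩ := hL (f.map (algebraMap _ L)) (hf.map _) (by rwa [hf.natDegree_map])
  have hx' : IsIntegral (_root_.integralClosure R L) x :=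
    ⟨f, hf, by rwa [IsRoot, Polynomial.eval_map] at hx⟩
  have hx'' : IsIntegral R x := isIntegral_trans x hx'
  refine ⟨⟨x, hx''⟩, ?_⟩
  have hinj : Function.Injective (algebraMap (_root_.integralClosure R L) L) :=
    Subtype.val_injective
  apply hinj
  rw [map_zero]
  rw [IsRoot, Polynomial.eval_map] at hx
  rw [← hx]
  exact (eval₂_at_apply (algebraMap (_root_.integralClosure R L) L) ⟨x, hx''⟩).symm

/-- Scaling the roots by a common denominator `t` multiplies the coefficient of index `i` by `t ^ (n
- i)`. For `i < n` one factor clears the denominator, and the leading coefficient stays `1`; so the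
scaled polynomial lifts to `R`, and dividing a root by `t` undoes the scaling. -/
lemma localization {R S : Type*} [CommRing R] [CommRing S] [Algebra R S] (M : Submonoid R)
    [IsLocalization M S] (hR : AbsIntClosed R) : AbsIntClosed S := by
  intro f hf hd
  nontriviality S
  classical
  obtain ⟨s, hs⟩ := IsLocalization.exist_integer_multiples_of_finset M
    ((Finset.range (f.natDegree + 1)).image f.coeff)
  set t : S := algebraMap R S s with ht
  have hcoeff : ∀ i, i ≠ f.natDegree → (f.scaleRoots t).coeff i ∈ (algebraMap R S).range := by
    intro i hi
    rw [coeff_scaleRoots]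
    rcases lt_or_gt_of_ne hi with h | h
    · obtain ⟨k, hk⟩ : ∃ k, f.natDegree - i = k + 1 := ⟨f.natDegree - i - 1, by omega⟩
      rw [hk, pow_succ', ← mul_assoc]
      refine Subring.mul_mem _ ?_ (Subring.pow_mem _ (RingHom.mem_range_self _ _) _)
      obtain ⟨a, ha⟩ := hs (f.coeff i) (Finset.mem_image_of_mem _ (Finset.mem_range.2 (by omega)))
      exact ⟨a, by rw [ha, Algebra.smul_def, mul_comm]⟩
    · rw [coeff_eq_zero_of_natDegree_lt h, zero_mul]
      exact Subring.zero_mem _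
  have hmon : (f.scaleRoots t).Monic := (monic_scaleRoots_iff t).2 hf
  obtain ⟨g, hg, hgd, hgm⟩ := lifts_and_natDegree_eq_and_monic (f := algebraMap R S)
    ((lifts_iff_coeff_lifts (f := algebraMap R S) (f.scaleRoots t)).2 (fun i => by
      by_cases hi : i = f.natDegree
      · refine ⟨1, ?_⟩
        rw [hi, ← natDegree_scaleRoots f t, hmon.coeff_natDegree, map_one]
      · exact hcoeff i hi)) hmon
  obtain ⟨x, hx⟩ := hR g hgm (by rwa [hgd, natDegree_scaleRoots])
  have hx2 := hx.map (f := algebraMap R S)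
  rw [hg] at hx2
  obtain ⟨u, hu⟩ := IsLocalization.map_units S s
  have hy := scaleRoots_aeval_eq_zero (A := S) (r := ((u⁻¹ : Sˣ) : S)) (a := algebraMap R S x)
    (p := f.scaleRoots t) (by simpa [IsRoot, coe_aeval_eq_eval] using hx2)
  rw [← scaleRoots_mul] at hy
  have h1 : t * ((u⁻¹ : Sˣ) : S) = 1 := by rw [ht, ← hu, Units.mul_inv]
  rw [h1, scaleRoots_one] at hy
  exact ⟨_, by simpa [coe_aeval_eq_eval] using hy⟩

lemma isAlgClosed {k : Type*} [Field k] (hk : AbsIntClosed k) : IsAlgClosed k :=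
  IsAlgClosed.of_exists_root k fun p hp hi => hk p hp hi.natDegree_pos.ne'

lemma exists_pow_eq {R : Type*} [CommRing R] (hR : AbsIntClosed R) (a : R) {n : ℕ} (hn : n ≠ 0) :
    ∃ b, b ^ n = a := by
  nontriviality R
  obtain ⟨x, hx⟩ := hR (X ^ n - C a) (monic_X_pow_sub_C a hn) (by rwa [natDegree_X_pow_sub_C])
  exact ⟨x, by simpa [sub_eq_zero] using hx⟩

end AbsIntClosed

/-! ### Stalks and residue fields of the normalization -/

section Normalization

variable {𝔛₀ : Scheme.{u}} [IsIntegral 𝔛₀] {K : Type u} [Field K] [Algebra 𝔛₀.functionField K]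

lemma geomPoint_apply (y : Spec (.of K)) : geomPoint 𝔛₀ K y = genericPoint 𝔛₀ := by
  rw [geomPoint, Scheme.Hom.comp_apply]
  have : Subsingleton (Spec (𝔛₀.presheaf.stalk (genericPoint 𝔛₀))) :=
    inferInstanceAs (Subsingleton (PrimeSpectrum 𝔛₀.functionField))
  rw [Subsingleton.elim (Spec.map (CommRingCat.ofHom (algebraMap 𝔛₀.functionField K)) y)
    (IsLocalRing.closedPoint _), Scheme.fromSpecStalk_closedPoint]

lemma geomPoint_preimage {U : 𝔛₀.Opens} (hU : (U : Set 𝔛₀).Nonempty) :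
    geomPoint 𝔛₀ K ⁻¹ᵁ U = ⊤ := by
  refine top_unique fun y _ => ?_
  change geomPoint 𝔛₀ K y ∈ U
  rw [geomPoint_apply]
  simpa using ((genericPoint_spec 𝔛₀).mem_open_set_iff U.2).2 (by simpa using hU)

variable [IsAlgClosed K]

/-- Over an affine open of `𝔛₀` the normalization is the spectrum of the integral closure of the
sections in `K`, since nonempty opens contain the generic point. Existence of roots passes from `K`
to the integral closure and then to its localizations. -/
lemma absIntClosed_stalk (x : normalizationIn 𝔛₀ K) :
    AbsIntClosed ((normalizationIn 𝔛₀ K).presheaf.stalk x) := by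
  set f := geomPoint 𝔛₀ K
  obtain ⟨U, hU, hxU, -⟩ := exists_isAffineOpen_mem_and_subset
    (x := f.fromNormalization x) (U := ⊤) trivial
  have hW : IsAffineOpen (f.fromNormalization ⁻¹ᵁ U) := hU.preimage _
  have h1 : AbsIntClosed Γ(Spec (.of K), f ⁻¹ᵁ U) := by
    rw [geomPoint_preimage ⟨_, hxU⟩]
    exact (AbsIntClosed.of_isAlgClosed K).of_surjective (Scheme.ΓSpecIso (.of K)).inv.hom
      (Scheme.ΓSpecIso (.of K)).symm.commRingCatIsoToRingEquiv.surjective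
  have h2 : AbsIntClosed Γ(f.normalization, f.fromNormalization ⁻¹ᵁ U) := by
    let := (f.app U).hom.toAlgebra
    exact (h1.integralClosure (R := Γ(𝔛₀, U))).of_surjective (f.normalizationObjIso hU).inv.hom
      (f.normalizationObjIso hU).symm.commRingCatIsoToRingEquiv.surjective
  let : Algebra Γ(f.normalization, f.fromNormalization ⁻¹ᵁ U)
      ((normalizationIn 𝔛₀ K).presheaf.stalk x) :=
    TopCat.Presheaf.algebra_section_stalk (normalizationIn 𝔛₀ K).presheaf ⟨x, hxU⟩
  have := hW.isLocalization_stalk ⟨x, hxU⟩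
  exact h2.localization (hW.primeIdealOf ⟨x, hxU⟩).asIdeal.primeCompl

instance isAlgClosed_residueField (x : normalizationIn 𝔛₀ K) :
    IsAlgClosed ((normalizationIn 𝔛₀ K).residueField x) :=
  ((absIntClosed_stalk x).of_surjective _ (Scheme.residue_surjective _ x)).isAlgClosed

end Normalization

/-! ### Values of sections and the maps `F_ν` on pairs -/

open scoped Classical in
/-- The extension of a complex character of the units of a field by the value zero at zero. -/
noncomputable def extendZero {F : Type*} [Field F] (χ : Fˣ →* ℂˣ) : F →*₀ ℂ where
  toFun a := if h : a = 0 then 0 else (χ (Units.mk0 a h) : ℂ)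
  map_zero' := by simp
  map_one' := by simp
  map_mul' a b := by
    by_cases ha : a = 0
    · simp [ha]
    by_cases hb : b = 0
    · simp [hb]
    simp [ha, hb, Units.mk0_mul]

lemma extendZero_units {F : Type*} [Field F] (χ : Fˣ →* ℂˣ) (a : Fˣ) :
    extendZero χ a = χ a := by
  simp [extendZero]

lemma extendZero_mk0 {F : Type*} [Field F] (χ : Fˣ →* ℂˣ) {a : F} (h : a ≠ 0) :
    extendZero χ a = χ (Units.mk0 a h) := by
  simp [extendZero, h]

lemma extendZero_comp_map {F L : Type*} [Field F] [Field L] (φ : F →+* L) (χ : Lˣ →* ℂˣ) (a : F) :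
    extendZero (χ.comp (Units.map φ.toMonoidHom)) a = extendZero χ (φ a) := by
  by_cases ha : a = 0
  · simp [ha]
  · have h2 : φ a ≠ 0 := by simpa using ha
    rw [extendZero_mk0 _ ha, extendZero_mk0 _ h2]
    exact congrArg (fun u => ((χ u : ℂˣ) : ℂ)) (Units.ext rfl)

namespace CPoint

variable {X Y : Scheme.{u}}

lemma value_eq (z : CPoint X) (U : X.Opens) (hz : z.pt ∈ U) (f : Γ(X, U)) :
    z.value U hz f = extendZero z.char (X.evaluation U z.pt hz f) := by
  unfold value
  split_ifs with h
  · rw [h, map_zero]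
  · rw [extendZero_mk0 _ h]

lemma value_pow (z : CPoint X) (U : X.Opens) (hz : z.pt ∈ U) (f : Γ(X, U)) (n : ℕ) :
    z.value U hz (f ^ n) = z.value U hz f ^ n := by
  rw [value_eq, value_eq, map_pow, map_pow]

lemma value_smul (ν : ℕ+) (z : CPoint X) (U : X.Opens) (hz : z.pt ∈ U) (f : Γ(X, U)) :
    (ν • z).value U hz f = z.value U hz f ^ (ν : ℕ) := by
  rw [value_eq, value_eq]
  change extendZero (z.char.comp (powMonoidHom (ν : ℕ))) (X.evaluation U z.pt hz f) = _
  by_cases h : X.evaluation U z.pt hz f = 0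
  · rw [h, map_zero, map_zero, zero_pow ν.ne_zero]
  · rw [extendZero_mk0 _ h, extendZero_mk0 _ h]
    simp

lemma value_map (z : CPoint X) {U V : X.Opens} (h : V ≤ U) (hz : z.pt ∈ V) (f : Γ(X, U)) :
    z.value V hz (X.presheaf.map (homOfLE h).op f) = z.value U (h hz) f := by
  rw [value_eq, value_eq]
  congr 1
  change X.residue z.pt (X.presheaf.germ V z.pt hz (X.presheaf.map (homOfLE h).op f)) = _
  rw [TopCat.Presheaf.germ_res_apply]
  rfl

lemma isOpen_setOf_value_mem (U : X.Opens) (f : Γ(X, U)) {V : Set ℂ} (hV : IsOpen V) :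
    IsOpen {z : CPoint X | ∃ hz : z.pt ∈ U, z.value U hz f ∈ V} :=
  TopologicalSpace.isOpen_generateFrom_of_mem ⟨U, f, V, hV, rfl⟩

lemma continuous_smul (ν : ℕ+) : Continuous (fun z : CPoint X => ν • z) := by
  refine continuous_generateFrom_iff.2 ?_
  rintro _ ⟨U, f, V, hV, rfl⟩
  convert isOpen_setOf_value_mem U f (hV.preimage (continuous_pow (ν : ℕ))) using 1
  ext z
  refine exists_congr fun hz => ?_
  rw [Set.mem_preimage]
  exact iff_of_eq (congrArg (· ∈ V) (value_smul ν z U hz f))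

lemma torsionInjective_of_smul {ν : ℕ+} {z : CPoint X} (h : ν • z ∈ torsionInjective X) :
    z ∈ torsionInjective X := by
  intro a ha b hb hab
  refine h ha hb ?_
  change z.char (a ^ (ν : ℕ)) = z.char (b ^ (ν : ℕ))
  rw [map_pow, map_pow, hab]

lemma push_mem_torsionInjective (a : X ⟶ Y) {z : CPoint X} (h : z ∈ torsionInjective X) :
    z.push a ∈ torsionInjective Y := by
  intro b hb c hc hbc
  refine Units.map_injective (f := (a.residueFieldMap z.pt).hom.toMonoidHom)
    (RingHom.injective _) (h ?_ ?_ hbc)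
  · exact MonoidHom.isOfFinOrder _ hb
  · exact MonoidHom.isOfFinOrder _ hc

lemma push_mem_fibre_iff (a : X ⟶ Y) {z : CPoint X} {n : ℕ} :
    z.push a ∈ fibre Y n ↔ z ∈ fibre X n :=
  (RingHom.charP_iff (a.residueFieldMap z.pt).hom (RingHom.injective _) n)

lemma fibre_unique {z : CPoint X} {m n : ℕ} (hm : z ∈ fibre X m) (hn : z ∈ fibre X n) : m = n :=
  @CharP.eq _ _ _ _ hm hn

/-- A character that is trivial on the elements killed by `ν` is in the image of `F_ν`, if all
elements of the residue field are `ν`-th powers. -/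
lemma exists_smul_eq (z : CPoint X) [IsAlgClosed (X.residueField z.pt)] (ν : ℕ+)
    (h : ∀ a : (X.residueField z.pt)ˣ, a ^ (ν : ℕ) = 1 → z.char a = 1) :
    ∃ w : CPoint X, ν • w = z := by
  have hsurj : Function.Surjective
      (powMonoidHom (ν : ℕ) : (X.residueField z.pt)ˣ →* (X.residueField z.pt)ˣ) := by
    intro a
    obtain ⟨b, hb⟩ := IsAlgClosed.exists_pow_nat_eq (a : X.residueField z.pt) ν.pos
    have hb0 : b ≠ 0 := by
      rintro rfl
      rw [zero_pow ν.ne_zero] at hb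
      exact a.ne_zero hb.symm
    exact ⟨Units.mk0 b hb0, Units.ext hb⟩
  -- The character descends along the surjective `ν`-th power map because it is trivial on its
  -- kernel.
  refine ⟨⟨z.pt, (powMonoidHom (ν : ℕ)).liftOfSurjective hsurj ⟨z.char, ?_⟩⟩, ?_⟩
  · intro a ha
    exact h a ha
  · change CPoint.mk z.pt _ = _
    congr 1
    exact MonoidHom.liftOfRightInverse_comp _ _ _ _

/-- Every unit is a `ν`-th power, so `P` is determined by its values on `ν`-th powers. -/
lemma smul_injective [∀ x : X, IsAlgClosed (X.residueField x)] (ν : ℕ+) :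
    Function.Injective (fun z : CPoint X => ν • z) := by
  rintro ⟨x, P⟩ ⟨y, Q⟩ h
  obtain ⟨h1, h2⟩ := CPoint.mk.inj h
  change x = y at h1
  subst h1
  congr 1
  refine MonoidHom.ext fun a => ?_
  obtain ⟨b, hb⟩ := IsAlgClosed.exists_pow_nat_eq (a : X.residueField x) ν.pos
  have hb0 : b ≠ 0 := by
    rintro rfl
    rw [zero_pow ν.ne_zero] at hb
    exact a.ne_zero hb.symm
  have hab : a = (Units.mk0 b hb0) ^ (ν : ℕ) := Units.ext hb.symm
  rw [hab]
  exact congrArg (fun φ => φ (Units.mk0 b hb0)) (eq_of_heq h2)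

/-- A root exists in the stalk; both the root and the equation it satisfies extend to a
neighbourhood. -/
lemma exists_section_pow_eq {x : X} (hX : AbsIntClosed (X.presheaf.stalk x)) {n : ℕ} (hn : n ≠ 0)
    {U : X.Opens} (hx : x ∈ U) (f : Γ(X, U)) :
    ∃ (V : X.Opens) (h : V ≤ U) (_ : x ∈ V) (g : Γ(X, V)),
      g ^ n = X.presheaf.map (homOfLE h).op f := by
  obtain ⟨b, hb⟩ := hX.exists_pow_eq (X.presheaf.germ U x hx f) hn
  obtain ⟨W, hxW, g, rfl⟩ := TopCat.Presheaf.exists_germ_eq X.presheaf b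
  rw [← map_pow] at hb
  obtain ⟨V, hxV, i, j, hV⟩ := TopCat.Presheaf.germ_eq X.presheaf x hxW hx _ _ hb
  refine ⟨V, j.le, hxV, X.presheaf.map i.op g, ?_⟩
  rw [← map_pow]
  exact hV

/-- If `g ^ ν = f` near `x`, the value of `f` at `(x, P)` is the value of `g` at `F_ν (x, P)`. Hence
subbasic open sets are locally preimages of open sets under `F_ν`. -/
lemma isInducing_smul (hX : ∀ x : X, AbsIntClosed (X.presheaf.stalk x)) (ν : ℕ+) :
    Topology.IsInducing (fun z : CPoint X => ν • z) := by
  refine ⟨le_antisymm (continuous_smul ν).le_induced (le_generateFrom ?_)⟩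
  rintro _ ⟨U, f, V, hV, rfl⟩
  refine (@isOpen_iff_forall_mem_open _ (_) _).2 ?_
  rintro z ⟨hz, hzV⟩
  obtain ⟨U', hU, hx, g, hg⟩ := exists_section_pow_eq (hX z.pt) ν.ne_zero hz f
  have key : ∀ (y : CPoint X) (hy : y.pt ∈ U'),
      (ν • y).value U' hy g = y.value U (hU hy) f := by
    intro y hy
    rw [value_smul, ← value_pow, hg, value_map]
  refine ⟨(fun z : CPoint X => ν • z) ⁻¹' {y | ∃ hy : y.pt ∈ U', y.value U' hy g ∈ V}, ?_, ?_, ?_⟩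
  · rintro y ⟨hy, hyV⟩
    exact ⟨hU hy, by rw [← key y hy]; exact hyV⟩
  · exact @IsOpen.preimage _ _ (_) _ _ continuous_induced_dom _ (isOpen_setOf_value_mem U' g hV)
  · exact ⟨hx, by rw [key z hx]; exact hzV⟩

end CPoint

/-! ### Galois quotients, the homeomorphism `F_p`, and continuity -/

section Galois

variable {𝔛₀ : Scheme.{u}} [IsIntegral 𝔛₀] {K : Type u} [Field K] [Algebra 𝔛₀.functionField K]

namespace GalQuot

variable {S T : Set (CPoint (normalizationIn 𝔛₀ K))}

/-- The class of a pair in the quotient by the Galois group. -/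
noncomputable def mk (z : S) : GalQuot S := Quotient.mk _ z

lemma mk_surjective : Function.Surjective (mk : S → GalQuot S) := Quotient.mk_surjective

lemma isQuotientMap_mk : Topology.IsQuotientMap (mk : S → GalQuot S) := isQuotientMap_quotient_mk'

lemma mk_eq_mk_iff {z w : S} :
    mk z = mk w ↔ ∃ σ : K ≃ₐ[𝔛₀.functionField] K, σ • w.1 = z.1 :=
  Quotient.eq (r := (MulAction.orbitRel _ _).comap _)

lemma continuous_incl (h : S ⊆ T) : Continuous (incl h) :=
  isQuotientMap_mk.continuous_iff.2
    (isQuotientMap_mk.continuous.comp (Continuous.subtype_mk continuous_subtype_val _))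

lemma continuous_frob (ν : ℕ+) (h : ∀ z ∈ S, ν • z ∈ T) : Continuous (frob ν h) :=
  isQuotientMap_mk.continuous_iff.2
    (isQuotientMap_mk.continuous.comp
      (((CPoint.continuous_smul ν).comp continuous_subtype_val).subtype_mk _))

end GalQuot

lemma gal_smul_mem_fibre_iff (σ : K ≃ₐ[𝔛₀.functionField] K) {z : CPoint (normalizationIn 𝔛₀ K)}
    {n : ℕ} : σ • z ∈ CPoint.fibre _ n ↔ z ∈ CPoint.fibre _ n :=
  CPoint.push_mem_fibre_iff _

namespace CharCondition

variable (E : CharCondition 𝔛₀ K)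

lemma isHomeomorph_frobPiece [IsAlgClosed K] (p : Nat.Primes) : IsHomeomorph (E.frobPiece p) := by
  let F : E.piece p → E.piece p := fun z => ⟨(p : ℕ+) • z.1, E.frob_mem_piece p z.1 z.2⟩
  have hF : Topology.IsInducing F := by
    have h := (CPoint.isInducing_smul (X := normalizationIn 𝔛₀ K) absIntClosed_stalk
      (p : ℕ+)).comp (Topology.IsInducing.subtypeVal (t := E.piece p))
    exact h.of_comp (((CPoint.continuous_smul _).comp continuous_subtype_val).subtype_mk _)
      continuous_subtype_val
  have hFs : Function.Surjective F := by
    rintro ⟨z, hz⟩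
    have : Fact (p : ℕ).Prime := ⟨p.2⟩
    have : CharP ((normalizationIn 𝔛₀ K).residueField z.pt) (p : ℕ) := hz.2.2
    obtain ⟨w, hw⟩ := z.exists_smul_eq (p : ℕ+) (fun a ha => by
      -- Frobenius is injective on a field of characteristic `p`, so the condition on `p`-torsion is
      -- vacuous.
      have : a = 1 := by
        refine Units.ext (frobenius_inj ((normalizationIn 𝔛₀ K).residueField z.pt) (p : ℕ) ?_)
        rw [Units.val_one, map_one]
        exact congrArg Units.val ha
      rw [this, map_one])
    subst hw
    exact ⟨⟨w, (E.frob_mem_iff _ _).1 hz.1, CPoint.torsionInjective_of_smul hz.2.1, hz.2.2⟩, rfl⟩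
  have hmk : ∀ z, E.frobPiece p (GalQuot.mk z) = GalQuot.mk (F z) := fun z => rfl
  have hinj : Function.Injective (E.frobPiece p) := by
    intro a b hab
    obtain ⟨z, rfl⟩ := GalQuot.mk_surjective a
    obtain ⟨w, rfl⟩ := GalQuot.mk_surjective b
    rw [hmk, hmk, GalQuot.mk_eq_mk_iff] at hab
    obtain ⟨σ, hσ⟩ := hab
    refine GalQuot.mk_eq_mk_iff.2 ⟨σ, CPoint.smul_injective (p : ℕ+) ?_⟩
    change (p : ℕ+) • σ • w.1 = (p : ℕ+) • z.1
    rw [← gal_smul_comm]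
    exact hσ
  refine ⟨GalQuot.continuous_frob _ _, ?_, hinj, ?_⟩
  -- Openness is tested on pairs. The preimage of `U` is `F ⁻¹' W` with `W` open, and by
  -- surjectivity of `F` the preimage of the image of `U` is `W` itself.
  · intro U hU
    rw [← GalQuot.isQuotientMap_mk.isOpen_preimage] at hU ⊢
    obtain ⟨W, hW, hWU⟩ := hF.isOpen_iff.1 hU
    convert hW using 1
    ext z
    obtain ⟨w, rfl⟩ := hFs z
    have h1 : F w ∈ W ↔ w ∈ GalQuot.mk ⁻¹' U := by rw [← hWU]; rfl
    rw [h1, Set.mem_preimage, ← hmk, hinj.mem_set_image]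
    rfl
  · intro a
    obtain ⟨z, rfl⟩ := GalQuot.mk_surjective a
    obtain ⟨w, rfl⟩ := hFs z
    exact ⟨_, hmk w⟩

lemma continuous_toTarget (n : ℕ) : Continuous (E.toTarget n) := by
  refine continuous_quotient_mk'.comp (Continuous.prodMk ?_ continuous_snd)
  refine Continuous.comp (g := Quotient.mk (frobSetoid _)) continuous_quotient_mk' ?_
  exact continuous_sigmaMk.comp ((GalQuot.continuous_incl _).comp continuous_fst)

lemma continuous_canonicalMap : Continuous E.canonicalMap := by
  refine (E.continuous_toTarget 0).sumElim (continuous_sigma fun p => ?_)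
  exact (isQuotientMap_quotient_mk' (s := torusSetoid (E.frobPiece p) (p : ℕ+))).continuous_iff.2
    (E.continuous_toTarget p)

lemma canonicalMap_sourceFlow (t : ℝ) (s : E.Source) :
    E.canonicalMap (E.sourceFlow t s) = Suspension.flow t (E.canonicalMap s) := by
  rcases s with ⟨P, u⟩ | ⟨p, ⟨P, u⟩⟩ <;> rfl

end CharCondition

end Galois

/-! ### Equality of points of a suspension -/

section Suspension

variable {Y : Type u} [MulAction ℕ+ Y]

/-- The point of the suspension given by an element of the copy `Y_a` and a positive real. -/
def Suspension.mk (a : ℕ+) (P : Y) (u : PosReal) : Suspension Y :=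
  Quotient.mk'' (FrobColim.mk a P, u)

/-- The relation of the colimit and the action of the positive rationals combine into one relation
with positive integer multipliers, after clearing denominators. -/
lemma Suspension.mk_eq_mk_iff {a b : ℕ+} {P Q : Y} {u v : PosReal} :
    Suspension.mk a P u = Suspension.mk b Q v ↔
      ∃ k l : ℕ+, k • P = l • Q ∧ (k * a : ℝ) * (u : ℝ) = (l * b : ℝ) * (v : ℝ) := by
  have hsmul : ∀ (q : PosRat), (((q • v : PosReal) : ℝ)) = ((q : ℚ) : ℝ) * (v : ℝ) := fun _ => rfl
  have hq : ∀ q : PosRat, ((q : ℚ) : ℝ) = (q.num : ℝ) / (q.den : ℝ) := fun q => by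
    rw [← q.num_div_den]; push_cast; rfl
  constructor
  · intro h
    obtain ⟨q, h⟩ := Quotient.exact h
    obtain ⟨h1, h2⟩ := Prod.ext_iff.1 h
    replace h1 : q • FrobColim.mk b Q = FrobColim.mk a P := h1
    replace h2 : q • v = u := h2
    rw [FrobColim.smul_mk, FrobColim.mk_eq_mk_iff] at h1
    obtain ⟨c, hc⟩ := h1
    refine ⟨c * (q.den * b), c * a * q.num, ?_, ?_⟩
    · exact hc.symm.trans (mul_smul _ _ _).symm
    · rw [← h2, hsmul, hq]
      have : (q.den : ℝ) ≠ 0 := by simp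
      push_cast
      field_simp
  · rintro ⟨k, l, h1, h2⟩
    refine Quotient.sound ?_
    -- The second coordinates leave only this choice, since `q` has to carry `v` to `u`.
    let q : PosRat := ⟨((l * b : ℕ+) : ℚ) / ((k * a : ℕ+) : ℚ), by
      have : ((l * b : ℕ+) : ℚ) ≠ 0 ∧ ((k * a : ℕ+) : ℚ) ≠ 0 := by constructor <;> simp
      positivity⟩
    have hqv : ((q : ℚ) : ℝ) = (l * b : ℝ) / (k * a : ℝ) := by simp [q]
    have hka : (k * a : ℝ) ≠ 0 := by simp
    have hden : (q.den : ℝ) ≠ 0 := by simp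
    have hnd : q.num * (k * a) = q.den * (l * b) := by
      have h3 := hq q
      rw [hqv, div_eq_div_iff hka hden] at h3
      apply PNat.coe_injective
      have h4 : ((q.num : ℕ) : ℝ) * ((k : ℕ) * (a : ℕ)) = (q.den : ℕ) * ((l : ℕ) * (b : ℕ)) := by
        linarith
      exact_mod_cast h4
    refine ⟨q, Prod.ext ?_ (Subtype.ext ?_)⟩
    · change q • FrobColim.mk b Q = FrobColim.mk a P
      rw [FrobColim.smul_mk, FrobColim.mk_eq_mk_iff]
      refine ⟨k * l, ?_⟩
      calc (k * l * a) • q.num • Q = (k * a * q.num) • l • Q := by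
            rw [← mul_smul, ← mul_smul]; congr 1; ring
        _ = (k * (q.num * (k * a))) • P := by rw [← h1, ← mul_smul]; congr 1; ring
        _ = _ := by rw [hnd]; congr 1; ring
    · change ((q • v : PosReal) : ℝ) = u
      rw [hsmul, hqv]
      field_simp
      linarith

lemma Suspension.mk_surjective (s : Suspension Y) : ∃ a P u, Suspension.mk a P u = s := by
  obtain ⟨⟨⟨a, P⟩, u⟩⟩ := s
  exact ⟨a, P, u, rfl⟩

end Suspension

/-! ### Roots of unity -/

section RootsOfUnity

variable {F : Type*} [Field F] [IsAlgClosed F]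

/-- Apply the hypothesis to a primitive `m`-th root of unity, which exists since `m` is invertible
in `F`. -/
lemma dvd_of_forall_pow_eq_one {k l m : ℕ} (hm : (m : F) ≠ 0) (hmk : m ∣ k)
    (h : ∀ ζ : Fˣ, IsOfFinOrder ζ → ζ ^ k = 1 → ζ ^ l = 1) : m ∣ l := by
  have : NeZero (m : F) := ⟨hm⟩
  have hm0 : m ≠ 0 := by rintro rfl; simp at hm
  have : NeZero m := ⟨hm0⟩
  obtain ⟨ζ, hζ⟩ := HasEnoughRootsOfUnity.exists_primitiveRoot F m
  have hu : IsPrimitiveRoot (hζ.isUnit hm0).unit m :=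
    IsPrimitiveRoot.coe_units_iff.1 (by simpa using hζ)
  exact (hu.pow_eq_one_iff_dvd l).1 (h _ (isOfFinOrder_iff_pow_eq_one.2
    ⟨m, Nat.pos_of_ne_zero hm0, hu.pow_eq_one⟩) ((hu.pow_eq_one_iff_dvd k).2 hmk))

lemma eq_of_forall_pow_eq_one_iff [CharZero F] {k l : ℕ} (hk : k ≠ 0) (hl : l ≠ 0)
    (h : ∀ ζ : Fˣ, IsOfFinOrder ζ → (ζ ^ k = 1 ↔ ζ ^ l = 1)) : k = l :=
  Nat.dvd_antisymm
    (dvd_of_forall_pow_eq_one (F := F) (by exact_mod_cast hk) dvd_rfl fun ζ hζ => (h ζ hζ).1)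
    (dvd_of_forall_pow_eq_one (F := F) (by exact_mod_cast hl) dvd_rfl fun ζ hζ => (h ζ hζ).2)

/-- In characteristic `p` roots of unity detect exactly the prime-to-`p` parts of `k` and `l`, which
must therefore coincide. -/
lemma exists_eq_pow_mul_of_forall_pow_eq_one_iff (p : ℕ) [Fact p.Prime] [CharP F p] {k l : ℕ}
    (hk : k ≠ 0) (hl : l ≠ 0)
    (h : ∀ ζ : Fˣ, IsOfFinOrder ζ → (ζ ^ k = 1 ↔ ζ ^ l = 1)) :
    ∃ i j N, k = p ^ i * N ∧ l = p ^ j * N := by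
  have hp : p.Prime := Fact.out
  obtain ⟨i, k', hk', rfl⟩ := Nat.exists_eq_pow_mul_and_not_dvd hk p hp.ne_one
  obtain ⟨j, l', hl', rfl⟩ := Nat.exists_eq_pow_mul_and_not_dvd hl p hp.ne_one
  have h1 := dvd_of_forall_pow_eq_one (F := F) (by rwa [Ne, CharP.cast_eq_zero_iff F p])
    (dvd_mul_left k' (p ^ i)) fun ζ hζ => (h ζ hζ).1
  have h2 := dvd_of_forall_pow_eq_one (F := F) (by rwa [Ne, CharP.cast_eq_zero_iff F p])
    (dvd_mul_left l' (p ^ j)) fun ζ hζ => (h ζ hζ).2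
  refine ⟨i, j, k', rfl, ?_⟩
  rw [Nat.dvd_antisymm
    ((((Nat.Prime.coprime_iff_not_dvd hp).2 hk').symm.pow_right j).dvd_of_dvd_mul_left h1)
    ((((Nat.Prime.coprime_iff_not_dvd hp).2 hl').symm.pow_right i).dvd_of_dvd_mul_left h2)]

/-- A field has at most `n` roots of unity of order dividing `n`, so a subgroup of order `n`
exhausts them. -/
lemma mem_of_pow_card_eq_one {F : Type*} [Field F] (T : Subgroup Fˣ) [Finite T] {a : Fˣ}
    (ha : a ^ Nat.card T = 1) : a ∈ T := by
  have : NeZero (Nat.card T) := ⟨Nat.card_pos.ne'⟩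
  have heq : (T : Set Fˣ) = (rootsOfUnity (Nat.card T) F : Set Fˣ) :=
    Set.eq_of_subset_of_ncard_le
      (fun a ha => congrArg Subtype.val (pow_card_eq_one' (x := (⟨a, ha⟩ : T))))
      (card_rootsOfUnity F (Nat.card T)) (inferInstanceAs (Finite (rootsOfUnity (Nat.card T) F)))
  change a ∈ (T : Set Fˣ)
  rw [heq]
  exact ha

end RootsOfUnity

/-! ### Pairs with injective or finite-kernel characters on roots of unity -/

namespace CPoint

variable {X : Scheme.{u}}

lemma fibre_zero_or_prime (z : CPoint X) : z ∈ fibre X 0 ∨ ∃ p : Nat.Primes, z ∈ fibre X p := by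
  obtain ⟨n, hn⟩ := CharP.exists (X.residueField z.pt)
  rcases CharP.char_is_prime_or_zero (X.residueField z.pt) n with h | rfl
  · exact Or.inr ⟨⟨n, h⟩, hn⟩
  · exact Or.inl hn

lemma pow_eq_one_iff_of_smul_eq {z : CPoint X} (hz : z ∈ torsionInjective X) {k : ℕ+}
    {ζ : (X.residueField z.pt)ˣ} (hζ : IsOfFinOrder ζ) :
    ζ ^ (k : ℕ) = 1 ↔ (k • z).char ζ = 1 := by
  change _ ↔ z.char (ζ ^ (k : ℕ)) = 1
  exact ⟨fun h => by rw [h, map_one], fun h => hz (IsOfFinOrder.pow hζ) IsOfFinOrder.one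
    (by rw [h, map_one])⟩

/-- For torsion-injective `z` the torsion kernel of `F_k z` is `μ_k`, so the common pair `F_k z =
F_l w` determines both groups of roots of unity. -/
lemma pow_eq_one_iff_pow_eq_one {z w : CPoint X} (hz : z ∈ torsionInjective X)
    (hw : w ∈ torsionInjective X) {k l : ℕ+} (h : k • z = l • w)
    (ζ : (X.residueField z.pt)ˣ) (hζ : IsOfFinOrder ζ) :
    ζ ^ (k : ℕ) = 1 ↔ ζ ^ (l : ℕ) = 1 := by
  obtain ⟨x, P⟩ := z
  obtain ⟨y, Q⟩ := w
  obtain ⟨h1, h2⟩ := CPoint.mk.inj h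
  change x = y at h1
  subst h1
  refine (pow_eq_one_iff_of_smul_eq (k := k) hz hζ).trans
    (Iff.trans ?_ (pow_eq_one_iff_of_smul_eq (k := l) hw hζ).symm)
  exact iff_of_eq (congrArg (fun φ => φ ζ = 1) (eq_of_heq h2))

lemma smul_eq_smul_char {z w : CPoint X} {k l : ℕ+} (h : k • z = l • w) {m n : ℕ}
    (hz : z ∈ fibre X m) (hw : w ∈ fibre X n) : m = n := by
  refine fibre_unique (z := k • z) hz ?_
  rw [h]
  exact hw

variable [∀ x : X, IsAlgClosed (X.residueField x)]

lemma eq_of_smul_eq_smul {z w : CPoint X} (hz : z ∈ torsionInjective X)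
    (hw : w ∈ torsionInjective X) (h0 : z ∈ fibre X 0) {k l : ℕ+} (h : k • z = l • w) :
    k = l ∧ z = w := by
  have : CharP (X.residueField z.pt) 0 := h0
  have : CharZero (X.residueField z.pt) := CharP.charP_to_charZero _
  have hkl : k = l := PNat.coe_injective <| eq_of_forall_pow_eq_one_iff
    (F := X.residueField z.pt) k.ne_zero l.ne_zero (pow_eq_one_iff_pow_eq_one hz hw h)
  subst hkl
  exact ⟨rfl, smul_injective k h⟩

lemma pow_smul_eq_of_smul_eq_smul {z w : CPoint X} (hz : z ∈ torsionInjective X)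
    (hw : w ∈ torsionInjective X) (p : Nat.Primes) (h0 : z ∈ fibre X p) {k l : ℕ+}
    (h : k • z = l • w) :
    ∃ (i j : ℕ) (N : ℕ+), k = (p : ℕ+) ^ i * N ∧ l = (p : ℕ+) ^ j * N ∧
      ((p : ℕ+) ^ i) • z = ((p : ℕ+) ^ j) • w := by
  have : CharP (X.residueField z.pt) p := h0
  have : Fact (p : ℕ).Prime := ⟨p.2⟩
  obtain ⟨i, j, N, hk, hl⟩ := exists_eq_pow_mul_of_forall_pow_eq_one_iff
    (F := X.residueField z.pt) p k.ne_zero l.ne_zero (pow_eq_one_iff_pow_eq_one hz hw h)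
  lift N to ℕ+ using Nat.pos_of_ne_zero (by rintro rfl; exact k.ne_zero hk)
  have hk' : k = (p : ℕ+) ^ i * N := PNat.coe_injective (by
    rw [hk]; push_cast; rfl)
  have hl' : l = (p : ℕ+) ^ j * N := PNat.coe_injective (by
    rw [hl]; push_cast; rfl)
  refine ⟨i, j, N, hk', hl', smul_injective N ?_⟩
  dsimp only
  rw [← mul_smul, ← mul_smul, mul_comm, ← hk', mul_comm, ← hl', h]

/-- A character with finite kernel on the roots of unity is `F_ν` of one that is injective on
them. -/
lemma exists_smul_eq_of_mem_torsionFinite {z : CPoint X} (hz : z ∈ torsionFinite X) :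
    ∃ (ν : ℕ+) (w : CPoint X), w ∈ torsionInjective X ∧ ν • w = z := by
  obtain ⟨n, h1, h2⟩ : ∃ n : ℕ+,
      (∀ a : (X.residueField z.pt)ˣ, a ^ (n : ℕ) = 1 → z.char a = 1) ∧
      ∀ a : (X.residueField z.pt)ˣ, IsOfFinOrder a → z.char a = 1 → a ^ (n : ℕ) = 1 := by
    -- The integer sought is the order of the torsion kernel, which is then the full group of roots
    -- of unity of that order.
    let T : Subgroup (X.residueField z.pt)ˣ := CommGroup.torsion _ ⊓ z.char.ker
    have : Finite T := hz
    have hpos : 0 < Nat.card T := Nat.card_pos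
    have hT : ∀ a ∈ T, a ^ Nat.card T = 1 := fun a ha =>
      congrArg Subtype.val (pow_card_eq_one' (x := (⟨a, ha⟩ : T)))
    refine ⟨⟨Nat.card T, hpos⟩, fun a ha => ?_, fun a ha h1 => hT a ⟨ha, h1⟩⟩
    have haT : a ∈ T := mem_of_pow_card_eq_one T ha
    exact haT.2
  obtain ⟨w, rfl⟩ := z.exists_smul_eq n h1
  refine ⟨n, w, ?_, rfl⟩
  -- Writing `a = b ^ n` turns `w.char a = 1` into triviality of the original character on `b`; so
  -- `b` lies in the torsion kernel, which is killed by `n`, and `a = 1`.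
  have hone : ∀ a : (X.residueField w.pt)ˣ, IsOfFinOrder a → w.char a = 1 → a = 1 := by
    intro a ha hwa
    obtain ⟨b, hb⟩ := IsAlgClosed.exists_pow_nat_eq (a : X.residueField w.pt) n.pos
    have hb0 : b ≠ 0 := by
      rintro rfl
      rw [zero_pow n.ne_zero] at hb
      exact a.ne_zero hb.symm
    have hab : (Units.mk0 b hb0) ^ (n : ℕ) = a := Units.ext hb
    rw [← hab]
    refine h2 _ (IsOfFinOrder.of_pow (n := n) (hab ▸ ha) n.ne_zero) ?_
    change w.char (Units.mk0 b hb0 ^ (n : ℕ)) = 1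
    rw [hab, hwa]
  intro a ha b hb hab
  have h2 := hone (a * b⁻¹) (ha.mul hb.inv)
    (by rw [map_mul, map_inv, hab, mul_inv_cancel])
  rwa [mul_inv_eq_one] at h2

end CPoint

/-! ### Bijectivity of the canonical map -/

namespace CharCondition

variable {𝔛₀ : Scheme.{u}} [IsIntegral 𝔛₀] {K : Type u} [Field K] [Algebra 𝔛₀.functionField K]
  (E : CharCondition 𝔛₀ K)

lemma smul_mk (ν : ℕ+) (z : E.carrier) :
    ν • (GalQuot.mk z : GalQuot E.carrier) = GalQuot.mk ⟨ν • z.1, (E.frob_mem_iff ν z.1).2 z.2⟩ :=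
  rfl

lemma suspension_mk_eq {a b : ℕ+} {z w : E.carrier} {u v : PosReal}
    (h : Suspension.mk a (GalQuot.mk z : GalQuot E.carrier) u = Suspension.mk b (GalQuot.mk w) v) :
    ∃ (σ : K ≃ₐ[𝔛₀.functionField] K) (k l : ℕ+), k • z.1 = l • σ • w.1 ∧
      (k * a : ℝ) * (u : ℝ) = (l * b : ℝ) * (v : ℝ) := by
  obtain ⟨k, l, h1, h2⟩ := Suspension.mk_eq_mk_iff.1 h
  rw [smul_mk, smul_mk, GalQuot.mk_eq_mk_iff] at h1
  obtain ⟨σ, hσ⟩ := h1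
  exact ⟨σ, k, l, hσ.symm.trans (gal_smul_comm σ l w.1), h2⟩

lemma toTarget_eq_toTarget {m n : ℕ} {z : E.piece m} {w : E.piece n} {u v : PosReal}
    (h : E.toTarget m (GalQuot.mk z, u) = E.toTarget n (GalQuot.mk w, v)) :
    ∃ (σ : K ≃ₐ[𝔛₀.functionField] K) (k l : ℕ+), k • z.1 = l • σ • w.1 ∧
      (k : ℝ) * (u : ℝ) = (l : ℝ) * (v : ℝ) := by
  obtain ⟨σ, k, l, h1, h2⟩ := E.suspension_mk_eq h
  exact ⟨σ, k, l, h1, by simpa using h2⟩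

lemma char_eq_of_toTarget_eq {m n : ℕ} {s : GalQuot (E.piece m) × PosReal}
    {t : GalQuot (E.piece n) × PosReal} (h : E.toTarget m s = E.toTarget n t) : m = n := by
  obtain ⟨P, u⟩ := s
  obtain ⟨Q, v⟩ := t
  obtain ⟨z, rfl⟩ := GalQuot.mk_surjective P
  obtain ⟨w, rfl⟩ := GalQuot.mk_surjective Q
  obtain ⟨σ, k, l, h1, -⟩ := E.toTarget_eq_toTarget h
  exact CPoint.smul_eq_smul_char h1 z.2.2.2 ((gal_smul_mem_fibre_iff σ).2 w.2.2.2)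

lemma frobPiece_iterate_mk (p : Nat.Primes) (i : ℕ) (z : E.piece p) :
    ∃ h, (E.frobPiece p)^[i] (GalQuot.mk z) = GalQuot.mk ⟨(p : ℕ+) ^ i • z.1, h⟩ := by
  induction i with
  | zero => exact ⟨by simp, by simp⟩
  | succ i ih =>
    obtain ⟨h, hi⟩ := ih
    have e : (p : ℕ+) ^ (i + 1) • z.1 = (p : ℕ+) • (p : ℕ+) ^ i • z.1 := by
      rw [pow_succ', mul_smul]
    refine ⟨by rw [e]; exact E.frob_mem_piece p _ h, ?_⟩
    rw [Function.iterate_succ_apply', hi]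
    exact congrArg GalQuot.mk (Subtype.ext e.symm)

variable [IsAlgClosed K]

/-- Equality in the target gives `F_k z = F_l (σ w)` with `k u = l v`. The maps `F_k` and the Galois
group preserve the residue characteristic, which rules out the mixed cases; within one
characteristic the comparison of roots of unity applies. -/
lemma canonicalMap_injective : Function.Injective E.canonicalMap := by
  rintro (⟨P, u⟩ | ⟨p, ⟨P, u⟩⟩) (⟨Q, v⟩ | ⟨q, ⟨Q, v⟩⟩) h
  · change E.toTarget 0 (P, u) = E.toTarget 0 (Q, v) at h
    obtain ⟨z, rfl⟩ := GalQuot.mk_surjective P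
    obtain ⟨w, rfl⟩ := GalQuot.mk_surjective Q
    obtain ⟨σ, k, l, h1, h2⟩ := E.toTarget_eq_toTarget h
    obtain ⟨rfl, h3⟩ := CPoint.eq_of_smul_eq_smul z.2.2.1
      (CPoint.push_mem_torsionInjective (galHom σ⁻¹) w.2.2.1) z.2.2.2 h1
    have huv : u = v := Subtype.ext (mul_left_cancel₀ (by simp) h2)
    rw [huv, GalQuot.mk_eq_mk_iff.2 ⟨σ, h3.symm⟩]
  · exact absurd (E.char_eq_of_toTarget_eq (m := 0) (n := q) (s := (P, u)) (t := (Q, v)) h).symm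
      q.2.ne_zero
  · exact absurd (E.char_eq_of_toTarget_eq (m := p) (n := 0) (s := (P, u)) (t := (Q, v)) h)
      p.2.ne_zero
  · obtain rfl : p = q := Subtype.ext
      (E.char_eq_of_toTarget_eq (m := p) (n := q) (s := (P, u)) (t := (Q, v)) h)
    change E.toTarget p (P, u) = E.toTarget p (Q, v) at h
    refine congrArg (fun s : Torus (E.frobPiece p) p => (Sum.inr ⟨p, s⟩ : E.Source))
      (Quotient.sound (s := torusSetoid (E.frobPiece p) (p : ℕ+)) ?_)
    obtain ⟨z, rfl⟩ := GalQuot.mk_surjective P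
    obtain ⟨w, rfl⟩ := GalQuot.mk_surjective Q
    obtain ⟨σ, k, l, h1, h2⟩ := E.toTarget_eq_toTarget h
    obtain ⟨i, j, N, hk, hl, h3⟩ := CPoint.pow_smul_eq_of_smul_eq_smul z.2.2.1
      (CPoint.push_mem_torsionInjective (galHom σ⁻¹) w.2.2.1) p z.2.2.2 h1
    refine ⟨i, j, ?_, ?_⟩
    · obtain ⟨_, e1⟩ := E.frobPiece_iterate_mk p i z
      obtain ⟨_, e2⟩ := E.frobPiece_iterate_mk p j w
      dsimp only
      rw [e1, e2, GalQuot.mk_eq_mk_iff]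
      exact ⟨σ, by rw [gal_smul_comm]; exact h3.symm⟩
    · have hN : ((N : ℕ) : ℝ) ≠ 0 := by simp
      refine mul_left_cancel₀ hN ?_
      rw [hk, hl] at h2
      push_cast at h2
      change (N : ℝ) * ((p : ℕ) ^ i * (u : ℝ)) = (N : ℝ) * ((p : ℕ) ^ j * (v : ℝ))
      have h4 : ((p : ℕ) : ℝ) ^ i * (N : ℝ) * (u : ℝ) = ((p : ℕ) : ℝ) ^ j * (N : ℝ) * (v : ℝ) := h2
      linarith

lemma canonicalMap_surjective (hE : E.IsAdmissible) : Function.Surjective E.canonicalMap := by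
  intro s
  obtain ⟨a, P, u, rfl⟩ := Suspension.mk_surjective s
  obtain ⟨⟨z, hz⟩, rfl⟩ := GalQuot.mk_surjective P
  obtain ⟨ν, w, hw, rfl⟩ := CPoint.exists_smul_eq_of_mem_torsionFinite (hE hz)
  have hwE : w ∈ E.carrier := (E.frob_mem_iff ν w).1 hz
  -- The point `F_ν w` of the copy with index `a` corresponds to `w` in the copy with index `1`
  -- after the real coordinate is scaled by `a / ν`.
  let v : PosReal := ⟨(a : ℝ) / (ν : ℝ) * (u : ℝ), mul_pos
    (div_pos (by exact_mod_cast a.pos) (by exact_mod_cast ν.pos)) u.2⟩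
  have hv : Suspension.mk 1 (GalQuot.mk ⟨w, hwE⟩ : GalQuot E.carrier) v =
      Suspension.mk a (GalQuot.mk ⟨ν • w, hz⟩) u := by
    refine Suspension.mk_eq_mk_iff.2 ⟨ν, 1, ?_, ?_⟩
    · rw [smul_mk, one_smul]
    · change (ν * (1 : ℕ+) : ℝ) * ((a : ℝ) / (ν : ℝ) * (u : ℝ)) = _
      have : (ν : ℝ) ≠ 0 := by simp
      push_cast
      field_simp
  rw [← hv]
  rcases w.fibre_zero_or_prime with h0 | ⟨p, hp⟩
  · exact ⟨Sum.inl (GalQuot.mk ⟨w, hwE, hw, h0⟩, v), rfl⟩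
  · exact ⟨Sum.inr ⟨p, Quotient.mk _ (GalQuot.mk ⟨w, hwE, hw, hp⟩, v)⟩, rfl⟩

lemma canonicalMap_bijective (hE : E.IsAdmissible) : Function.Bijective E.canonicalMap :=
  ⟨E.canonicalMap_injective, E.canonicalMap_surjective hE⟩

end CharCondition

/-! ### Complex characters of abelian groups -/

section Characters

variable {G H : Type*} [CommGroup G] [CommGroup H]

/-- `ℂˣ` is divisible, hence an injective abelian group. -/
lemma exists_comp_eq_of_injective (j : H →* G) (hj : Function.Injective j) (φ : H →* ℂˣ) :
    ∃ ψ : G →* ℂˣ, ψ.comp j = φ := by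
  let : RootableBy ℂˣ ℕ := rootableByOfPowLeftSurj _ _ fun {n} hn a => by
    obtain ⟨b, hb⟩ := IsAlgClosed.exists_pow_nat_eq (a : ℂ) (Nat.pos_of_ne_zero hn)
    have hb0 : b ≠ 0 := by
      rintro rfl
      rw [zero_pow hn] at hb
      exact a.ne_zero hb.symm
    exact ⟨Units.mk0 b hb0, Units.ext hb⟩
  let : RootableBy ℂˣ ℤ := Group.rootableByIntOfRootableByNat _
  let : DivisibleBy (Additive ℂˣ) ℤ :=
    { div := fun a n => Additive.ofMul (RootableBy.root a.toMul n)
      div_zero := fun a => congrArg Additive.ofMul (RootableBy.root_zero a.toMul)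
      div_cancel := fun a hn => RootableBy.root_cancel a.toMul hn }
  obtain ⟨ψ, hψ⟩ := (Module.Baer.of_divisible (Additive ℂˣ)).extension_property
    (MonoidHom.toAdditive j).toIntLinearMap hj (MonoidHom.toAdditive φ).toIntLinearMap
  exact ⟨AddMonoidHom.toMultiplicative ψ.toAddMonoidHom, MonoidHom.ext fun a =>
    congrArg (fun θ : Additive H →ₗ[ℤ] Additive ℂˣ => (θ (Additive.ofMul a)).toMul) hψ⟩

/-- The character descends to `H / ker j`, which embeds in `G`. -/
lemma exists_comp_eq (j : H →* G) (φ : H →* ℂˣ) (h : j.ker ≤ φ.ker) :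
    ∃ ψ : G →* ℂˣ, ψ.comp j = φ := by
  obtain ⟨ψ, hψ⟩ := exists_comp_eq_of_injective (QuotientGroup.kerLift j)
    (QuotientGroup.kerLift_injective j) (QuotientGroup.lift j.ker φ h)
  refine ⟨ψ, MonoidHom.ext fun a => ?_⟩
  exact congrArg (fun χ => χ (a : H ⧸ j.ker)) hψ

/-- Characters can be glued along two subgroups. -/
lemma exists_character_eq_on (A B : Subgroup G) (φ ψ : G →* ℂˣ)
    (h : ∀ a ∈ A, a ∈ B → φ a = ψ a) :
    ∃ χ : G →* ℂˣ, (∀ a ∈ A, χ a = φ a) ∧ ∀ b ∈ B, χ b = ψ b := by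
  -- The quotient `φ / ψ` on `A` vanishes on `A ∩ B`, so it extends to a character of `G / B`;
  -- multiplying it by `ψ` corrects the values on `A` without changing those on `B`.
  obtain ⟨θ, hθ⟩ := exists_comp_eq ((QuotientGroup.mk' B).comp A.subtype)
    ((φ / ψ).comp A.subtype) (by
      intro a ha
      have : (a : G) ∈ B := (QuotientGroup.eq_one_iff (a : G)).1 ha
      change φ a / ψ a = 1
      rw [h a a.2 this, div_self'])
  refine ⟨ψ * θ.comp (QuotientGroup.mk' B), fun a ha => ?_, fun b hb => ?_⟩
  · have : θ (QuotientGroup.mk' B a) = φ a / ψ a := congrArg (fun χ => χ ⟨a, ha⟩) hθ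
    change ψ a * θ (QuotientGroup.mk' B a) = _
    rw [this, mul_div_cancel]
  · have : QuotientGroup.mk' B b = 1 := (QuotientGroup.eq_one_iff b).2 hb
    change ψ b * θ (QuotientGroup.mk' B b) = _
    rw [this, map_one, mul_one]

end Characters

/-! ### Torsion-injective characters of fields, and their twists -/

/-- Roots of unity lie in the algebraic closure of `ℚ` in `F`, which embeds into `ℂ`; the resulting
character extends to `Fˣ` by divisibility of `ℂˣ`. -/
lemma exists_character_injOn_torsion_of_charZero (F : Type*) [Field F] [CharZero F] :
    ∃ χ : Fˣ →* ℂˣ, Set.InjOn χ {a | IsOfFinOrder a} := by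
  let A := algebraicClosure ℚ F
  have : Algebra.IsAlgebraic ℚ A := algebraicClosure.isAlgebraic ℚ F
  let φ : A →+* ℂ := (IsAlgClosed.lift : A →ₐ[ℚ] ℂ).toRingHom
  obtain ⟨χ, hχ⟩ := exists_comp_eq_of_injective (Units.map (algebraMap A F).toMonoidHom)
    (Units.map_injective (algebraMap A F).injective) (Units.map φ.toMonoidHom)
  have hmem : ∀ a : Fˣ, IsOfFinOrder a → ∃ b : Aˣ, Units.map (algebraMap A F).toMonoidHom b = a := by
    intro a ha
    obtain ⟨n, hn, h1⟩ := isOfFinOrder_iff_pow_eq_one.1 ha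
    have hint : ∀ c : Fˣ, c ^ n = 1 → (c : F) ∈ A := fun c hc =>
      mem_algebraicClosure_iff'.2 (IsIntegral.of_pow hn (by
        rw [← Units.val_pow_eq_pow_val, hc]; exact isIntegral_one))
    refine ⟨⟨⟨a, hint a h1⟩, ⟨(a⁻¹ : Fˣ), hint _ (by rw [inv_pow, h1, inv_one])⟩, ?_, ?_⟩, ?_⟩
    · exact Subtype.ext (by simp)
    · exact Subtype.ext (by simp)
    · exact Units.ext rfl
  refine ⟨χ, fun a ha b hb hab => ?_⟩
  obtain ⟨a, rfl⟩ := hmem a ha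
  obtain ⟨b, rfl⟩ := hmem b hb
  have h1 : ∀ c, χ (Units.map (algebraMap A F).toMonoidHom c) = Units.map φ.toMonoidHom c :=
    fun c => congrArg (fun θ => θ c) hχ
  rw [h1, h1] at hab
  rw [Units.map_injective φ.injective hab]

/-- The Teichmüller map embeds `F` multiplicatively into the fraction field of its Witt vectors,
which has characteristic zero. -/
lemma exists_character_injOn_torsion_of_charP (F : Type*) [Field F] (p : ℕ) [Fact p.Prime]
    [CharP F p] : ∃ χ : Fˣ →* ℂˣ, Set.InjOn χ {a | IsOfFinOrder a} := by
  have : CharZero (WittVector p F) := by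
    obtain ⟨q, hq⟩ := CharP.exists (WittVector p F)
    rcases CharP.char_is_prime_or_zero (WittVector p F) q with h | rfl
    · have h1 : ((q : ℕ) : F) = 0 := by
        rw [← map_natCast (WittVector.constantCoeff : WittVector p F →+* F) q,
          CharP.cast_eq_zero, map_zero]
      rw [CharP.cast_eq_zero_iff F p, Nat.prime_dvd_prime_iff_eq Fact.out h] at h1
      subst h1
      exact absurd (CharP.cast_eq_zero (WittVector p F) p) (WittVector.p_nonzero p F)
    · exact CharP.charP_to_charZero _
  let L := FractionRing (WittVector p F)
  have : CharZero L := IsFractionRing.charZero (WittVector p F)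
  obtain ⟨χ, hχ⟩ := exists_character_injOn_torsion_of_charZero L
  let τ : F →* L := (algebraMap (WittVector p F) L).toMonoidHom.comp (WittVector.teichmuller p)
  have hτ : Function.Injective τ := by
    refine (IsFractionRing.injective (WittVector p F) L).comp fun a b hab => ?_
    have hab' : WittVector.teichmuller p a = WittVector.teichmuller p b := hab
    rw [← WittVector.teichmuller_coeff_zero p a, hab', WittVector.teichmuller_coeff_zero]
  refine ⟨χ.comp (Units.map τ), fun a ha b hb hab => Units.map_injective hτ (hχ ?_ ?_ hab)⟩
  · exact MonoidHom.isOfFinOrder _ ha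
  · exact MonoidHom.isOfFinOrder _ hb

open Filter Topology

/-- The torsion of a finitely generated abelian group has finite exponent. -/
lemma exists_pow_eq_one_of_mem_closure {G : Type*} [CommGroup G] (S : Finset G) :
    ∃ n : ℕ, n ≠ 0 ∧ ∀ a ∈ Subgroup.closure (S : Set G), IsOfFinOrder a → a ^ n = 1 := by
  let M := Additive (Subgroup.closure (S : Set G))
  have : Module.Finite ℤ M := Module.Finite.iff_addGroup_fg.2 inferInstance
  have hT : Module.IsTorsion ℤ (Submodule.torsion ℤ M) := Submodule.torsion_isTorsion
  obtain ⟨n, hn, hn0⟩ := Submodule.annihilator_top_inter_nonZeroDivisors hT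
  refine ⟨n.natAbs, by simpa using nonZeroDivisors.ne_zero hn0, fun a ha hfin => ?_⟩
  obtain ⟨k, hk, hak⟩ := isOfFinOrder_iff_pow_eq_one.1 hfin
  let x : M := Additive.ofMul ⟨a, ha⟩
  have hx : x ∈ Submodule.torsion ℤ M := by
    refine (Submodule.mem_torsion_iff _).2
      ⟨⟨k, mem_nonZeroDivisors_of_ne_zero (by exact_mod_cast hk.ne')⟩, ?_⟩
    change (k : ℤ) • x = 0
    rw [natCast_zsmul]
    exact congrArg Additive.ofMul (Subtype.ext hak : (⟨a, ha⟩ : Subgroup.closure (S : Set G)) ^ k = 1)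
  have h1 : n • (⟨x, hx⟩ : Submodule.torsion ℤ M) = 0 :=
    Submodule.mem_annihilator.1 hn _ trivial
  have h2 : a ^ n = 1 := congrArg (fun y : Submodule.torsion ℤ M => ((y : M).toMul : G)) h1
  rcases Int.natAbs_eq n with h | h
  · rw [h, zpow_natCast] at h2
    exact h2
  · rw [h, zpow_neg, zpow_natCast, inv_eq_one] at h2
    exact h2

section PrimaryCharacter

variable {G : Type*} [CommGroup G]

/-- A character that is injective on the torsion can be replaced by one that is injective on the
`p`-power torsion and trivial on the torsion of order prime to `p`. -/
lemma exists_character_primary (p : ℕ) {χ : G →* ℂˣ}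
    (hχ : Set.InjOn χ {a | IsOfFinOrder a}) (hp : p ≠ 0) :
    ∃ ψ : G →* ℂˣ, (∀ a k, a ^ p ^ k = 1 → ψ a = 1 → a = 1) ∧
      ∀ a m, m.Coprime p → a ^ m = 1 → ψ a = 1 := by
  let A : Subgroup G :=
    { carrier := {a | ∃ k, a ^ p ^ k = 1}
      mul_mem' := by
        rintro a b ⟨k, hk⟩ ⟨l, hl⟩
        refine ⟨k + l, ?_⟩
        rw [mul_pow, pow_add, pow_mul, hk, one_pow, mul_comm (p ^ k), pow_mul, hl, one_pow, one_mul]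
      one_mem' := ⟨0, by simp⟩
      inv_mem' := by
        rintro a ⟨k, hk⟩
        exact ⟨k, by rw [inv_pow, hk, inv_one]⟩ }
  let B : Subgroup G :=
    { carrier := {a | ∃ m, m.Coprime p ∧ a ^ m = 1}
      mul_mem' := by
        rintro a b ⟨k, hkp, hk⟩ ⟨l, hlp, hl⟩
        refine ⟨k * l, hkp.mul_left hlp, ?_⟩
        rw [mul_pow, pow_mul, hk, one_pow, mul_comm k, pow_mul, hl, one_pow, one_mul]
      one_mem' := ⟨1, by simp, by simp⟩
      inv_mem' := by
        rintro a ⟨k, hkp, hk⟩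
        exact ⟨k, hkp, by rw [inv_pow, hk, inv_one]⟩ }
  obtain ⟨ψ, h1, h2⟩ := exists_character_eq_on A B χ 1 (by
    -- The two subgroups meet trivially, because the order of a common element divides coprime
    -- integers.
    rintro a ⟨k, hk⟩ ⟨m, hm, ham⟩
    have h := orderOf_dvd_of_pow_eq_one hk
    have h' := orderOf_dvd_of_pow_eq_one ham
    have h'' := Nat.eq_one_of_dvd_coprimes (hm.pow_right k) h' h
    rw [orderOf_eq_one_iff.1 h'', map_one, map_one])
  refine ⟨ψ, fun a k hk ha => ?_, fun a m hm ham => h2 a ⟨m, hm, ham⟩⟩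
  rw [h1 a ⟨k, hk⟩] at ha
  exact hχ (isOfFinOrder_iff_pow_eq_one.2 ⟨p ^ k, by positivity, hk⟩) IsOfFinOrder.one
    (by rw [ha, map_one])

/-- Let `ρ` be a character that is injective on torsion of order prime to `p`, and trivial on
`p`-power torsion. It agrees on any finitely generated subgroup with a character that has
finite exponent on the torsion of its kernel. -/
lemma exists_twist (p : ℕ) [Fact p.Prime] {χ : G →* ℂˣ}
    (hχ : Set.InjOn χ {a | IsOfFinOrder a}) (ρ : G →* ℂˣ)
    (h1 : ∀ a k, a ^ p ^ k = 1 → ρ a = 1)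
    (h2 : ∀ a m, m.Coprime p → a ^ m = 1 → ρ a = 1 → a = 1) (S : Finset G) :
    ∃ (θ : G →* ℂˣ) (n : ℕ), n ≠ 0 ∧ (∀ a ∈ S, θ a = 1) ∧
      ∀ a, IsOfFinOrder a → ρ a * θ a = 1 → a ^ n = 1 := by
  have hp : p.Prime := Fact.out
  obtain ⟨ψ, hψ1, hψ2⟩ := exists_character_primary p hχ hp.ne_zero
  obtain ⟨n, hn, hS⟩ := exists_pow_eq_one_of_mem_closure S
  -- Triviality on the span of `S` is compatible with `ψ ^ n` on torsion because `n` kills the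
  -- torsion of that span.
  obtain ⟨θ, hθ1, hθ2⟩ := exists_character_eq_on (Subgroup.closure (S : Set G))
    (CommGroup.torsion G) 1 (ψ.comp (powMonoidHom n)) (by
      intro a ha hfin
      change 1 = ψ (a ^ n)
      rw [hS a ha hfin, map_one])
  refine ⟨θ, n, hn, fun a ha => hθ1 a (Subgroup.subset_closure ha), fun a ha h => ?_⟩
  have hθa : ∀ b, IsOfFinOrder b → θ b = ψ b ^ n := fun b hb => by
    rw [hθ2 b hb]
    exact map_pow ψ b n
  obtain ⟨d, hd, had⟩ := isOfFinOrder_iff_pow_eq_one.1 ha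
  obtain ⟨k, m, hm, rfl⟩ := Nat.exists_eq_pow_mul_and_not_dvd hd.ne' p hp.ne_one
  have hm' : m.Coprime p := ((Nat.Prime.coprime_iff_not_dvd hp).2 hm).symm
  have hak : (a ^ p ^ k) ^ m = 1 := by rw [← pow_mul, had]
  -- Raising to the power `p ^ k` leaves the prime-to-`p` part, where `ψ`, hence `θ`, is trivial and
  -- `ρ` is injective.
  have h3 : a ^ p ^ k = 1 := by
    refine h2 _ m hm' hak ?_
    have h4 := congrArg (· ^ p ^ k) h
    rw [hθa a ha, mul_pow, one_pow, ← map_pow, ← pow_mul, mul_comm n, pow_mul, ← map_pow,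
      hψ2 _ m hm' hak, one_pow, mul_one] at h4
    exact h4
  -- Now `a` is `p`-power torsion, so `ρ a = 1` and only `ψ (a ^ n) = 1` remains.
  rw [h1 a k h3, one_mul, hθa a ha, ← map_pow] at h
  exact hψ1 _ k (by rw [← pow_mul, mul_comm, pow_mul, h3, one_pow]) h

end PrimaryCharacter

/-! ### Valuation rings and limits of characters -/

section Valuation

variable {K : Type*} [Field K] (V : ValuationSubring K)

/-- In a polynomial relation for `f` two nonzero terms must have equal valuation; otherwise the
largest term alone determines the valuation of the sum, which is zero. Comparing these two terms
gives a power of `f` with the valuation of an element of `K₀`. -/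
lemma exists_valuation_pow_eq {K₀ : Type*} [Field K₀] [Algebra K₀ K] {f : K} (hf : f ≠ 0)
    (halg : IsAlgebraic K₀ f) :
    ∃ n : ℕ, n ≠ 0 ∧ ∃ c : K₀, c ≠ 0 ∧ V.valuation (f ^ n) = V.valuation (algebraMap K₀ K c) := by
  classical
  by_contra! hcon
  obtain ⟨q, hq, hqf⟩ := halg
  have hvf : V.valuation f ≠ 0 := by simpa using hf
  have key : ∀ i ∈ q.support, ∀ j ∈ q.support, i < j →
      V.valuation (algebraMap K₀ K (q.coeff i) * f ^ i) ≠
        V.valuation (algebraMap K₀ K (q.coeff j) * f ^ j) := by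
    intro i hi j hj hij h
    have hi0 : q.coeff i ≠ 0 := Polynomial.mem_support_iff.1 hi
    have hj0 : q.coeff j ≠ 0 := Polynomial.mem_support_iff.1 hj
    have hvj : V.valuation (algebraMap K₀ K (q.coeff j)) ≠ 0 := by simpa using hj0
    refine hcon (j - i) (by omega) (q.coeff i / q.coeff j) (div_ne_zero hi0 hj0) ?_
    have hji : f ^ j = f ^ (j - i) * f ^ i := by rw [← pow_add]; congr 1; omega
    rw [hji, ← mul_assoc, map_mul _ _ (f ^ i), map_mul _ _ (f ^ i)] at h
    have h' := mul_right_cancel₀ (by simpa using fun h => absurd h hf) h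
    rw [map_div₀, map_div₀, h', map_mul, mul_div_cancel_left₀ _ hvj]
  obtain ⟨j, hj, hmax⟩ := Finset.exists_max_image q.support
    (fun i => V.valuation (algebraMap K₀ K (q.coeff i) * f ^ i)) (Polynomial.support_nonempty.2 hq)
  have hsum := V.valuation.map_sum_eq_of_lt (s := q.support)
    (f := fun i => algebraMap K₀ K (q.coeff i) * f ^ i) hj (by
      intro i hi
      rw [Finset.mem_sdiff, Finset.mem_singleton] at hi
      refine lt_of_le_of_ne (hmax i hi.1) ?_
      rcases lt_or_gt_of_ne hi.2 with h | h
      · exact key i hi.1 j hj h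
      · exact (key j hj i hi.1 h).symm)
  have h0 : ∑ i ∈ q.support, algebraMap K₀ K (q.coeff i) * f ^ i = 0 := by
    rw [← hqf, Polynomial.aeval_def, Polynomial.eval₂_eq_sum, Polynomial.sum_def]
  rw [h0, map_zero] at hsum
  have hj0 : q.coeff j ≠ 0 := Polynomial.mem_support_iff.1 hj
  have : algebraMap K₀ K (q.coeff j) * f ^ j ≠ 0 := mul_ne_zero (by simpa using hj0) (pow_ne_zero _ hf)
  exact this (by simpa using hsum.symm)

/-- Over a discrete valuation ring, the value group of an algebraic extension has rank one. -/
lemma exists_valuation_pow_eq_pow {A K₀ : Type*} [CommRing A] [IsDomain A]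
    [IsDiscreteValuationRing A] [Field K₀] [Algebra A K₀] [IsFractionRing A K₀] [Algebra K₀ K]
    [Algebra.IsAlgebraic K₀ K] (j : A →+* V) [IsLocalHom j]
    (hj : ∀ a, (j a : K) = algebraMap K₀ K (algebraMap A K₀ a)) {ϖ : A} (hϖ : Irreducible ϖ)
    {f : K} (hf : f ≠ 0) (hf1 : V.valuation f < 1) :
    ∃ n k : ℕ, n ≠ 0 ∧ k ≠ 0 ∧ V.valuation f ^ n = V.valuation (j ϖ : K) ^ k := by
  have hpow : ∀ a : A, a ≠ 0 → ∃ i : ℕ, V.valuation (j a : K) = V.valuation (j ϖ : K) ^ i := by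
    intro a ha
    obtain ⟨i, u, hu⟩ := IsDiscreteValuationRing.associated_pow_irreducible ha hϖ
    refine ⟨i, ?_⟩
    have h1 : V.valuation (j (u : A) : K) = 1 :=
      (V.valuation_eq_one_iff _).1 ((u.isUnit).map j)
    rw [← map_pow, ← SubmonoidClass.coe_pow, ← map_pow, ← hu, map_mul]
    push_cast
    rw [map_mul, h1, mul_one]
  have hϖ1 : V.valuation (j ϖ : K) < 1 := by
    refine (V.valuation_lt_one_iff _).1 ?_
    rw [IsLocalRing.mem_maximalIdeal]
    exact fun h => hϖ.not_isUnit (isUnit_of_map_unit j _ h)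
  have hϖ0 : V.valuation (j ϖ : K) ≠ 0 := by
    rw [hj]
    simpa using hϖ.ne_zero
  obtain ⟨n, hn, c, hc, h⟩ := exists_valuation_pow_eq V (K₀ := K₀) hf
    (Algebra.IsAlgebraic.isAlgebraic f)
  obtain ⟨a, b, hb, rfl⟩ := IsFractionRing.div_surjective (A := A) c
  have hb0 : b ≠ 0 := nonZeroDivisors.ne_zero hb
  have ha0 : a ≠ 0 := by
    rintro rfl
    simp at hc
  obtain ⟨i, hi⟩ := hpow a ha0
  obtain ⟨l, hl⟩ := hpow b hb0
  rw [map_div₀, map_div₀, ← hj, ← hj, hi, hl, map_pow, eq_div_iff (pow_ne_zero _ hϖ0)] at h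
  have hlt : V.valuation f ^ n < 1 := pow_lt_one₀ zero_le hf1 hn
  have hil : l < i := by
    by_contra! hle
    have h3 : V.valuation (j ϖ : K) ^ l ≤ V.valuation (j ϖ : K) ^ i :=
      pow_le_pow_right_of_le_one' hϖ1.le hle
    rw [← h] at h3
    have h4 : V.valuation f ^ n * V.valuation (j ϖ : K) ^ l < V.valuation (j ϖ : K) ^ l :=
      mul_lt_of_lt_one_left (zero_lt_iff.2 (pow_ne_zero _ hϖ0)) hlt
    exact absurd h3 (not_le.2 h4)
  refine ⟨n, i - l, hn, by omega, ?_⟩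
  refine mul_right_cancel₀ (pow_ne_zero l hϖ0) ?_
  rw [h, ← pow_add]
  congr 1
  omega

/-- There is a character that is trivial on the units and contracts the maximal ideal. -/
lemma exists_contracting_character {A K₀ : Type*} [CommRing A] [IsDomain A]
    [IsDiscreteValuationRing A] [Field K₀] [Algebra A K₀] [IsFractionRing A K₀] [Algebra K₀ K]
    [Algebra.IsAlgebraic K₀ K] (j : A →+* V) [IsLocalHom j]
    (hj : ∀ a, (j a : K) = algebraMap K₀ K (algebraMap A K₀ a)) :
    ∃ h : Kˣ →* ℂˣ, (∀ a ∈ V.unitGroup, h a = 1) ∧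
      ∀ a : Kˣ, V.valuation (a : K) < 1 → ‖(h a : ℂ)‖ < 1 := by
  obtain ⟨ϖ, hϖ⟩ := IsDiscreteValuationRing.exists_irreducible A
  have hϖK : (j ϖ : K) ≠ 0 := by
    rw [hj]
    simpa using hϖ.ne_zero
  have hϖ1 : V.valuation (j ϖ : K) < 1 := by
    refine (V.valuation_lt_one_iff _).1 ?_
    rw [IsLocalRing.mem_maximalIdeal]
    exact fun h => hϖ.not_isUnit (isUnit_of_map_unit j _ h)
  let π : Kˣ := Units.mk0 (j ϖ : K) hϖK
  let half : ℂˣ := Units.mk0 (1 / 2) (by norm_num)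
  have hpow : ∀ k : ℕ, π ^ k ∈ V.unitGroup → k = 0 := by
    intro k hk
    by_contra h0
    rw [ValuationSubring.mem_unitGroup_iff, Units.val_pow_eq_pow_val, map_pow] at hk
    exact (pow_lt_one₀ zero_le hϖ1 h0).ne hk
  -- The uniformizer has infinite order in the value group `Kˣ / Vˣ`, so its value may be
  -- prescribed; any number of norm in `(0, 1)` would serve in place of `1 / 2`.
  obtain ⟨ψ, hψ⟩ := exists_comp_eq_of_injective (G := Kˣ ⧸ V.unitGroup)
    ((QuotientGroup.mk' V.unitGroup).comp (zpowersHom Kˣ π)) (by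
      rw [injective_iff_map_eq_one]
      intro k hk
      have hk' : π ^ k.toAdd ∈ V.unitGroup := (QuotientGroup.eq_one_iff _).1 hk
      have : k.toAdd = 0 := by
        rcases Int.natAbs_eq k.toAdd with h | h
        · rw [h, zpow_natCast] at hk'
          have := hpow _ hk'
          omega
        · rw [h, zpow_neg, zpow_natCast, inv_mem_iff] at hk'
          have := hpow _ hk'
          omega
      exact Multiplicative.toAdd.injective this) (zpowersHom ℂˣ half)
  have hunit : ∀ a ∈ V.unitGroup, ψ (QuotientGroup.mk' V.unitGroup a) = 1 := fun a ha => by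
    rw [(QuotientGroup.eq_one_iff a).2 ha |> id (α := QuotientGroup.mk' V.unitGroup a = 1), map_one]
  have hπ : ψ (QuotientGroup.mk' V.unitGroup π) = half := by
    have := congrArg (fun θ => θ (Multiplicative.ofAdd (1 : ℤ))) hψ
    simpa using this
  refine ⟨ψ.comp (QuotientGroup.mk' V.unitGroup), hunit, fun a ha => ?_⟩
  obtain ⟨n, k, hn, hk, h⟩ := exists_valuation_pow_eq_pow V j hj hϖ a.ne_zero ha
  -- Since `a ^ n` and `π ^ k` differ by a unit, `‖h a‖ ^ n = (1 / 2) ^ k`.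
  have hmem : a ^ n * (π ^ k)⁻¹ ∈ V.unitGroup := by
    rw [ValuationSubring.mem_unitGroup_iff]
    have : V.valuation (j ϖ : K) ^ k ≠ 0 := pow_ne_zero _ (by simpa using hϖK)
    push_cast
    rw [map_mul, map_inv₀, map_pow, map_pow, h]
    exact mul_inv_cancel₀ this
  have h1 := hunit _ hmem
  rw [map_mul, map_inv, map_mul, map_inv, mul_inv_eq_one, map_pow, map_pow, map_pow, map_pow,
    hπ] at h1
  have h2 : ‖((ψ (QuotientGroup.mk' V.unitGroup a) : ℂˣ) : ℂ)‖ ^ n = (1 / 2) ^ k := by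
    rw [← norm_pow, ← Units.val_pow_eq_pow_val, h1]
    simp [half]
  by_contra! hge
  have h3 : (1 : ℝ) ≤ ‖((ψ (QuotientGroup.mk' V.unitGroup a) : ℂˣ) : ℂ)‖ ^ n := one_le_pow₀ hge
  rw [h2] at h3
  exact absurd h3 (not_le.2 (pow_lt_one₀ (by norm_num) (by norm_num) hk))

lemma residue_pow_eq_one {a : V.unitGroup} {n : ℕ} (h : (a : Kˣ) ^ n = 1) :
    V.unitGroupToResidueFieldUnits a ^ n = 1 := by
  rw [← map_pow, show a ^ n = 1 from Subtype.ext h, map_one]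

lemma mem_unitGroup_of_isOfFinOrder {a : Kˣ} (ha : IsOfFinOrder a) : a ∈ V.unitGroup := by
  obtain ⟨n, hn, h⟩ := isOfFinOrder_iff_pow_eq_one.1 ha
  rw [ValuationSubring.mem_unitGroup_iff, ← pow_eq_one_iff_of_nonneg zero_le hn.ne', ← map_pow,
    ← Units.val_pow_eq_pow_val, h, Units.val_one, map_one]

/-- Reduction is injective on the roots of unity of order prime to the residue characteristic. -/
lemma eq_one_of_residue_eq_one (p : ℕ) [Fact p.Prime]
    [CharP (IsLocalRing.ResidueField V) p] {a : V.unitGroup} {m : ℕ} (hm : m.Coprime p)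
    (ham : (a : Kˣ) ^ m = 1) (h : V.unitGroupToResidueFieldUnits a = 1) : a = 1 := by
  by_contra ha
  let x : V := V.unitGroupMulEquiv a
  have hx : IsLocalRing.residue V x = 1 := congrArg Units.val h
  have hxm : x ^ m = 1 := Subtype.ext (congrArg Units.val ham)
  have hx1 : x - 1 ≠ 0 := by
    rw [sub_ne_zero]
    intro h1
    exact ha (Subtype.ext (Units.ext (congrArg Subtype.val h1)))
  -- The factor `1 + x + ⋯ + x ^ (m - 1)` of `x ^ m - 1` vanishes, yet it reduces to `m`, which is
  -- nonzero modulo `p`.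
  have hsum : ∑ i ∈ Finset.range m, x ^ i = 0 := by
    refine (mul_eq_zero.1 ?_).resolve_right hx1
    rw [geom_sum_mul, hxm, sub_self]
  have h2 := congrArg (IsLocalRing.residue V) hsum
  rw [map_sum, map_zero] at h2
  simp only [map_pow, hx, one_pow, Finset.sum_const, Finset.card_range, nsmul_eq_mul, mul_one] at h2
  rw [CharP.cast_eq_zero_iff _ p] at h2
  exact (Fact.out : p.Prime).ne_one (Nat.eq_one_of_dvd_coprimes hm h2 dvd_rfl)

/-- A character of the residue field of `V` is a pointwise limit on `V` of characters of `K` that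
have finite kernel on the roots of unity. -/
lemma exists_tendsto_character [CharZero K] (p : ℕ) [Fact p.Prime]
    [CharP (IsLocalRing.ResidueField V) p] (h : Kˣ →* ℂˣ) (h1 : ∀ a ∈ V.unitGroup, h a = 1)
    (hlt : ∀ a : Kˣ, V.valuation (a : K) < 1 → ‖(h a : ℂ)‖ < 1)
    (P : (IsLocalRing.ResidueField V)ˣ →* ℂˣ) (hP : Set.InjOn P {a | IsOfFinOrder a}) :
    ∃ w : Finset Kˣ × ℕ → (Kˣ →* ℂˣ),
      (∀ i, {a : Kˣ | IsOfFinOrder a ∧ w i a = 1}.Finite) ∧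
      ∀ a : V, Tendsto (fun i => extendZero (w i) (a : K)) atTop
        (𝓝 (extendZero P (IsLocalRing.residue V a))) := by
  obtain ⟨ρ, hρ⟩ := exists_comp_eq_of_injective V.unitGroup.subtype Subtype.val_injective
    (P.comp V.unitGroupToResidueFieldUnits)
  have hρ' : ∀ a : V.unitGroup, ρ a = P (V.unitGroupToResidueFieldUnits a) := fun a =>
    congrArg (fun θ => θ a) hρ
  obtain ⟨χ, hχ⟩ := exists_character_injOn_torsion_of_charZero K
  have hfin : ∀ {a : Kˣ} {n : ℕ}, n ≠ 0 → a ^ n = 1 → IsOfFinOrder a := fun hn h =>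
    isOfFinOrder_iff_pow_eq_one.2 ⟨_, Nat.pos_of_ne_zero hn, h⟩
  have hpp : p.Prime := Fact.out
  have hρ1 : ∀ (a : Kˣ) k, a ^ p ^ k = 1 → ρ a = 1 := by
    intro a k hk
    have ha := mem_unitGroup_of_isOfFinOrder V (hfin (pow_ne_zero k hpp.ne_zero) hk)
    have h2 := residue_pow_eq_one V (a := ⟨a, ha⟩) hk
    have h3 : V.unitGroupToResidueFieldUnits ⟨a, ha⟩ = 1 := by
      refine Units.ext ((iterateFrobenius_inj (IsLocalRing.ResidueField V) p k) ?_)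
      rw [iterateFrobenius_def, iterateFrobenius_def, Units.val_one, one_pow]
      exact congrArg Units.val h2
    rw [hρ' ⟨a, ha⟩, h3, map_one]
  have hρ2 : ∀ (a : Kˣ) m, m.Coprime p → a ^ m = 1 → ρ a = 1 → a = 1 := by
    intro a m hm ham ha1
    have hm0 : m ≠ 0 := by
      rintro rfl
      exact hpp.ne_one (by simpa using hm)
    have ha := mem_unitGroup_of_isOfFinOrder V (hfin hm0 ham)
    rw [hρ' ⟨a, ha⟩] at ha1
    have h3 : V.unitGroupToResidueFieldUnits ⟨a, ha⟩ = 1 := by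
      refine hP (isOfFinOrder_iff_pow_eq_one.2
        ⟨m, Nat.pos_of_ne_zero hm0, residue_pow_eq_one V ham⟩) IsOfFinOrder.one ?_
      rw [ha1, map_one]
    exact congrArg Subtype.val (eq_one_of_residue_eq_one V p (a := ⟨a, ha⟩) hm ham h3)
  choose θ n hn hθS hθ using exists_twist p hχ ρ hρ1 hρ2
  -- The finite set in the index grows until the twist is invisible at any given element, while the
  -- exponent of `h` drives the values on the maximal ideal to zero. Roots of unity are units of
  -- `V`, so `h` does not affect the torsion kernel.
  refine ⟨fun i => ρ * θ i.1 * h ^ i.2, fun i => ?_, fun a => ?_⟩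
  · have : NeZero (n i.1) := ⟨hn i.1⟩
    have hfinite : (rootsOfUnity (n i.1) K : Set Kˣ).Finite :=
      inferInstanceAs (Finite (rootsOfUnity (n i.1) K))
    refine hfinite.subset ?_
    rintro a ⟨ha, ha1⟩
    refine hθ i.1 a ha ?_
    change ρ a * θ i.1 a * h a ^ i.2 = 1 at ha1
    rwa [h1 a (mem_unitGroup_of_isOfFinOrder V ha), one_pow, mul_one] at ha1
  · by_cases ha0 : (a : K) = 0
    · have : a = 0 := Subtype.ext ha0
      subst this
      simpa using tendsto_const_nhds (x := (0 : ℂ))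
    let x : Kˣ := Units.mk0 (a : K) ha0
    have hev : ∀ᶠ i : Finset Kˣ × ℕ in atTop,
        extendZero (ρ * θ i.1 * h ^ i.2) (a : K) = (ρ x : ℂ) * (h x : ℂ) ^ i.2 := by
      filter_upwards [eventually_ge_atTop (({x}, 0) : Finset Kˣ × ℕ)] with i hi
      have hx : x ∈ i.1 := hi.1 (Finset.mem_singleton_self x)
      rw [extendZero_mk0 _ ha0]
      change ((ρ x * θ i.1 x * h x ^ i.2 : ℂˣ) : ℂ) = _
      rw [hθS i.1 x hx, mul_one]
      push_cast
      rfl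
    refine Tendsto.congr' (hev.mono fun _ h => h.symm) ?_
    rcases V.valuation_lt_one_or_eq_one a with hv | hv
    · have hres : IsLocalRing.residue V a = 0 :=
        Ideal.Quotient.eq_zero_iff_mem.2 ((V.valuation_lt_one_iff a).2 hv)
      rw [hres, map_zero]
      have h4 : Tendsto (fun i : Finset Kˣ × ℕ => (h x : ℂ) ^ i.2) atTop (𝓝 0) := by
        rw [← prod_atTop_atTop_eq]
        exact (tendsto_pow_atTop_nhds_zero_of_norm_lt_one (hlt x hv)).comp tendsto_snd
      simpa using h4.const_mul (ρ x : ℂ)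
    · have hxu : x ∈ V.unitGroup := hv
      have h5 : IsLocalRing.residue V a = (V.unitGroupToResidueFieldUnits ⟨x, hxu⟩ :
        IsLocalRing.ResidueField V) := rfl
      rw [h5, extendZero_units, ← hρ']
      simpa [h1 x hxu] using tendsto_const_nhds (x := (ρ x : ℂ))

end Valuation

/-! ### Pairs coming from field-valued points -/

namespace CPoint

variable {X : Scheme.{u}}

/-- The pair given by a field-valued point and a character of the field. -/
noncomputable def ofField {L : Type u} [Field L] (a : Spec (.of L) ⟶ X) (χ : Lˣ →* ℂˣ) :
    CPoint X :=
  ⟨a (IsLocalRing.closedPoint L), χ.comp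
    (Units.map (X.descResidueField (Scheme.stalkClosedPointTo a)).hom.toMonoidHom)⟩

section OfField

variable {L : Type u} [Field L] (a : Spec (.of L) ⟶ X) (χ : Lˣ →* ℂˣ)

lemma value_ofField (U : X.Opens) (hU : a (IsLocalRing.closedPoint L) ∈ U) (f : Γ(X, U)) :
    (ofField a χ).value U hU f =
      extendZero χ (Scheme.stalkClosedPointTo a (X.presheaf.germ U _ hU f)) :=
  (value_eq _ U hU f).trans (extendZero_comp_map
    (X.descResidueField (Scheme.stalkClosedPointTo a)).hom χ _)

lemma ofField_mem_torsionInjective (h : Set.InjOn χ {a | IsOfFinOrder a}) :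
    ofField a χ ∈ torsionInjective X := by
  intro b hb c hc hbc
  refine Units.map_injective
    (f := (X.descResidueField (Scheme.stalkClosedPointTo a)).hom.toMonoidHom)
    (RingHom.injective _) (h ?_ ?_ hbc)
  · exact MonoidHom.isOfFinOrder _ hb
  · exact MonoidHom.isOfFinOrder _ hc

lemma ofField_mem_torsionFinite (h : {a | IsOfFinOrder a ∧ χ a = 1}.Finite) :
    ofField a χ ∈ torsionFinite X := by
  refine Set.Finite.of_finite_image
    (f := Units.map (X.descResidueField (Scheme.stalkClosedPointTo a)).hom.toMonoidHom)
    (Set.Finite.subset h ?_) (Units.map_injective (RingHom.injective _)).injOn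
  rintro _ ⟨b, ⟨hb, h1⟩, rfl⟩
  exact ⟨MonoidHom.isOfFinOrder _ hb, h1⟩

lemma ofField_mem_fibre (n : ℕ) [CharP L n] : ofField a χ ∈ fibre X n :=
  (RingHom.charP_iff (X.descResidueField (Scheme.stalkClosedPointTo a)).hom
    (RingHom.injective _) n).2 ‹_›

end OfField

lemma germ_stalkClosedPointTo_eq_appLE {R : CommRingCat.{u}} [IsLocalRing R] (f : Spec R ⟶ X)
    (U : X.Opens) (hU : f (IsLocalRing.closedPoint R) ∈ U) :
    X.presheaf.germ U _ hU ≫ Scheme.stalkClosedPointTo f =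
      f.appLE U ⊤ (Scheme.preimage_eq_top_of_closedPoint_mem f hU).ge ≫
        (Scheme.ΓSpecIso R).hom := by
  rw [Scheme.germ_stalkClosedPointTo]
  simp only [Iso.trans_hom, Functor.mapIso_hom, Iso.op_hom, Scheme.Hom.app_eq_appLE,
    Scheme.Hom.appLE_map_assoc]

lemma germ_stalkClosedPointTo_comp {V L : Type u} [CommRing V] [IsLocalRing V] [Field L]
    (g : Spec (.of V) ⟶ X) (φ : V →+* L) (U : X.Opens)
    (hU : g (IsLocalRing.closedPoint V) ∈ U)
    (hU' : (Spec.map (CommRingCat.ofHom φ) ≫ g) (IsLocalRing.closedPoint L) ∈ U) (f : Γ(X, U)) :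
    Scheme.stalkClosedPointTo (Spec.map (CommRingCat.ofHom φ) ≫ g) (X.presheaf.germ U _ hU' f) =
      φ (Scheme.stalkClosedPointTo g (X.presheaf.germ U _ hU f)) := by
  have key : X.presheaf.germ U _ hU' ≫
      Scheme.stalkClosedPointTo (Spec.map (CommRingCat.ofHom φ) ≫ g) =
      (X.presheaf.germ U _ hU ≫ Scheme.stalkClosedPointTo g) ≫ CommRingCat.ofHom φ := by
    refine (germ_stalkClosedPointTo_eq_appLE _ U hU').trans ?_
    refine Eq.trans ?_ (congrArg (· ≫ CommRingCat.ofHom φ)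
      (germ_stalkClosedPointTo_eq_appLE g U hU)).symm
    rw [Category.assoc, ← Scheme.ΓSpecIso_naturality, ← Category.assoc]
    refine congrArg (· ≫ (Scheme.ΓSpecIso (.of L)).hom) ?_
    have h := Scheme.Hom.appLE_comp_appLE (Spec.map (CommRingCat.ofHom φ)) g U ⊤ ⊤
      (Scheme.preimage_eq_top_of_closedPoint_mem g hU).ge le_top
    rw [← h, Scheme.Hom.appTop, Scheme.Hom.app_eq_appLE]
    rfl
  exact congrArg (fun ψ => ψ.hom f) key

end CPoint

/-! ### Codimension-one points in characteristic `p` and specialization -/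

section Specialization

variable {𝔛₀ : Scheme.{u}}

lemma finiteType_and_flat_section (hflat : Flat (specULiftZIsTerminal.from 𝔛₀))
    (hft : LocallyOfFiniteType (specULiftZIsTerminal.from 𝔛₀)) {U : 𝔛₀.Opens}
    (hU : IsAffineOpen U) : Module.Flat ℤ Γ(𝔛₀, U) ∧ Algebra.FiniteType ℤ Γ(𝔛₀, U) := by
  let f := specULiftZIsTerminal.from 𝔛₀
  let φ := f.appLE ⊤ U le_top
  let e : ℤ ≃+* Γ(Spec (.of (ULift.{u} ℤ)), ⊤) :=
    ULift.ringEquiv.symm.trans (Scheme.ΓSpecIso (.of (ULift.{u} ℤ))).symm.commRingCatIsoToRingEquiv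
  have h1 : φ.hom.Flat := HasRingHomProperty.appLE @Flat f hflat ⟨⊤, isAffineOpen_top _⟩ ⟨U, hU⟩ _
  have h2 : φ.hom.FiniteType :=
    HasRingHomProperty.appLE @LocallyOfFiniteType f hft ⟨⊤, isAffineOpen_top _⟩ ⟨U, hU⟩ _
  have h3 : algebraMap ℤ Γ(𝔛₀, U) = φ.hom.comp e.toRingHom := Subsingleton.elim _ _
  constructor
  · have : (algebraMap ℤ Γ(𝔛₀, U)).Flat := by
      rw [h3]
      exact (RingHom.Flat.of_bijective e.bijective).comp h1
    exact (RingHom.flat_algebraMap_iff).1 this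
  · have : (algebraMap ℤ Γ(𝔛₀, U)).FiniteType := by
      rw [h3]
      exact h2.comp (RingHom.FiniteType.of_surjective _ e.surjective)
    exact (RingHom.finiteType_algebraMap).1 this

lemma isJacobsonRing_int : IsJacobsonRing ℤ := by
  refine isJacobsonRing_iff_prime_eq.2 fun P hP => ?_
  by_cases h : P = ⊥
  · subst h
    refine le_antisymm (fun x hx => ?_) Ideal.le_jacobson
    -- The integer `x * x + 1` is a unit, which forces `x = 0`.
    have hu := Ideal.mem_jacobson_bot.1 hx x
    rw [Int.isUnit_iff] at hu
    have h0 : x * x = 0 := by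
      rcases hu with hu | hu
      · linarith
      · linarith [mul_self_nonneg x]
    exact mul_self_eq_zero.1 h0
  · exact Ideal.jacobson_eq_self_of_isMaximal (H := hP.isMaximal h)

/-- By the Nullstellensatz over the Jacobson ring `ℤ`, the residue field is finite over `ℤ`. In
characteristic zero this integral extension would make `ℤ` a field. -/
lemma exists_charP_quotient (R : Type*) [CommRing R] [Algebra.FiniteType ℤ R] (m : Ideal R)
    [m.IsMaximal] : ∃ p : ℕ, p.Prime ∧ (p : R) ∈ m := by
  let := Ideal.Quotient.field m
  obtain ⟨p, hp⟩ := CharP.exists (R ⧸ m)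
  refine ⟨p, (CharP.char_is_prime_or_zero (R ⧸ m) p).resolve_right ?_, ?_⟩
  · rintro rfl
    have : CharZero (R ⧸ m) := CharP.charP_to_charZero _
    have : Algebra.FiniteType ℤ (R ⧸ m) := Algebra.FiniteType.of_surjective
      (Ideal.Quotient.mkₐ ℤ m) Ideal.Quotient.mk_surjective
    have := isJacobsonRing_int
    have : Module.Finite ℤ (R ⧸ m) := finite_of_finite_type_of_isJacobsonRing ℤ (R ⧸ m)
    exact Int.not_isField (isField_of_isIntegral_of_isField
      (algebraMap ℤ (R ⧸ m)).injective_int (Field.toIsField (R ⧸ m)))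
  · rw [← Ideal.Quotient.eq_zero_iff_mem, map_natCast, CharP.cast_eq_zero]

/-- Krull's principal ideal theorem bounds the dimension by one; a noetherian integrally closed
local domain of dimension one is a discrete valuation ring. -/
lemma isDiscreteValuationRing_of_minimalPrimes {R S : Type*} [CommRing R] [IsNoetherianRing R]
    [CommRing S] [IsDomain S] [IsLocalRing S] [Algebra R S] [IsIntegrallyClosed S] {r : R}
    (P : Ideal R) [P.IsPrime] (hP : P ∈ (Ideal.span {r}).minimalPrimes)
    [IsLocalization.AtPrime S P] (hr : algebraMap R S r ≠ 0) : IsDiscreteValuationRing S := by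
  have hnoeth : IsNoetherianRing S := IsLocalization.isNoetherianRing P.primeCompl S inferInstance
  have hrm : algebraMap R S r ∈ IsLocalRing.maximalIdeal S := by
    rw [IsLocalization.AtPrime.to_map_mem_maximal_iff S P]
    exact hP.1.2 (Ideal.mem_span_singleton_self r)
  have hfield : ¬ IsField S := by
    rw [IsLocalRing.isField_iff_maximalIdeal_eq]
    intro h
    rw [h] at hrm
    exact hr hrm
  have hdim : ringKrullDim S ≤ 1 := by
    rw [IsLocalization.AtPrime.ringKrullDim_eq_height P S]
    exact_mod_cast Ideal.height_le_one_of_isPrincipal_of_mem_minimalPrimes (Ideal.span {r}) P hP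
  have : Ring.KrullDimLE 1 S := Ring.krullDimLE_iff.2 hdim
  have h1 := (Ring.krullDimLE_one_iff_of_noZeroDivisors (R := S)).1 this
  have htfae : IsDiscreteValuationRing S ↔
      IsIntegrallyClosed S ∧ ∃! P : Ideal S, P ≠ ⊥ ∧ P.IsPrime :=
    (IsDiscreteValuationRing.TFAE S hfield).out 0 3
  refine htfae.2 ⟨inferInstance, IsLocalRing.maximalIdeal S, ⟨?_, inferInstance⟩, ?_⟩
  · intro h
    rw [h] at hrm
    exact hr hrm
  · rintro Q ⟨hQ, hQp⟩
    exact IsLocalRing.eq_maximalIdeal (h1 Q hQ hQp)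

variable [IsIntegral 𝔛₀]

/-- A flat normal scheme of finite type over `ℤ` has a point of codimension one in positive
characteristic. -/
lemma exists_discreteValuationRing_stalk
    (hnormal : ∀ x : 𝔛₀, IsIntegrallyClosed (𝔛₀.presheaf.stalk x))
    (hflat : Flat (specULiftZIsTerminal.from 𝔛₀))
    (hft : LocallyOfFiniteType (specULiftZIsTerminal.from 𝔛₀)) :
    CharZero 𝔛₀.functionField ∧ ∃ (p : ℕ) (x : 𝔛₀), p.Prime ∧
      IsDiscreteValuationRing (𝔛₀.presheaf.stalk x) ∧
      (p : 𝔛₀.presheaf.stalk x) ∈ IsLocalRing.maximalIdeal (𝔛₀.presheaf.stalk x) := by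
  obtain ⟨U, hU, hηU, -⟩ := exists_isAffineOpen_mem_and_subset
    (x := genericPoint 𝔛₀) (U := ⊤) trivial
  have : Nonempty U := ⟨⟨_, hηU⟩⟩
  obtain ⟨h1, h2⟩ := finiteType_and_flat_section hflat hft hU
  have hR : CharZero Γ(𝔛₀, U) := by
    -- Flatness over `ℤ` enters here: the sections are torsion-free, so `p` is nonzero in them and a
    -- minimal prime over `p` has a nonzero element.
    have : Function.Injective (algebraMap ℤ Γ(𝔛₀, U)) := FaithfulSMul.algebraMap_injective _ _
    exact charZero_of_injective_algebraMap this
  have hnoeth : IsNoetherianRing Γ(𝔛₀, U) := Algebra.FiniteType.isNoetherianRing ℤ _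
  refine ⟨charZero_of_injective_ringHom
    (Scheme.germToFunctionField_injective 𝔛₀ U), ?_⟩
  obtain ⟨m, hm⟩ := Ideal.exists_maximal Γ(𝔛₀, U)
  obtain ⟨p, hp, hpm⟩ := exists_charP_quotient Γ(𝔛₀, U) m
  obtain ⟨P, hP, -⟩ := Ideal.exists_minimalPrimes_le
    ((Ideal.span_singleton_le_iff_mem m).2 hpm)
  have hPp : P.IsPrime := hP.1.1
  let y : PrimeSpectrum Γ(𝔛₀, U) := ⟨P, hPp⟩
  have hyU : hU.fromSpec y ∈ U := by
    have := Set.mem_range_self (f := hU.fromSpec) y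
    rwa [hU.range_fromSpec] at this
  let : Algebra Γ(𝔛₀, U) (𝔛₀.presheaf.stalk (hU.fromSpec y)) :=
    TopCat.Presheaf.algebra_section_stalk 𝔛₀.presheaf ⟨_, hyU⟩
  have : IsLocalization.AtPrime (𝔛₀.presheaf.stalk (hU.fromSpec y)) P :=
    hU.isLocalization_stalk' y hyU
  have hne : algebraMap Γ(𝔛₀, U) (𝔛₀.presheaf.stalk (hU.fromSpec y)) p ≠ 0 := by
    intro h
    rw [map_natCast] at h
    have h3 := congrArg (algebraMap (𝔛₀.presheaf.stalk (hU.fromSpec y)) 𝔛₀.functionField) h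
    have : CharZero 𝔛₀.functionField := charZero_of_injective_ringHom
      (Scheme.germToFunctionField_injective 𝔛₀ U)
    rw [map_natCast, map_zero, Nat.cast_eq_zero] at h3
    exact hp.ne_zero h3
  have := hnormal (hU.fromSpec y)
  refine ⟨p, hU.fromSpec y, hp, isDiscreteValuationRing_of_minimalPrimes P hP hne, ?_⟩
  have := (IsLocalization.AtPrime.to_map_mem_maximal_iff
    (𝔛₀.presheaf.stalk (hU.fromSpec y)) P (p : Γ(𝔛₀, U))).2
    (hP.1.2 (Ideal.mem_span_singleton_self _))
  rwa [map_natCast] at this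

variable {K : Type u} [Field K] [Algebra 𝔛₀.functionField K]

/-- The local rings of `𝔛₀` are dominated by valuation rings of `K`, and these have a center on
the normalization. -/
lemma exists_valuationSubring_center (x : 𝔛₀) :
    ∃ (V : ValuationSubring K) (j : 𝔛₀.presheaf.stalk x →+* V), IsLocalHom j ∧
      (∀ a, (j a : K) = algebraMap 𝔛₀.functionField K (algebraMap _ 𝔛₀.functionField a)) ∧
      Nonempty (Spec (.of V) ⟶ normalizationIn 𝔛₀ K) := by
  obtain ⟨V, hV, hloc⟩ := IsLocalRing.exists_factor_valuationRing
    ((algebraMap 𝔛₀.functionField K).comp (algebraMap (𝔛₀.presheaf.stalk x) 𝔛₀.functionField))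
  let j : 𝔛₀.presheaf.stalk x →+* V :=
    ((algebraMap 𝔛₀.functionField K).comp (algebraMap (𝔛₀.presheaf.stalk x)
      𝔛₀.functionField)).codRestrict V.toSubring hV
  have hsq : CommSq (geomPoint 𝔛₀ K).toNormalization
      (Spec.map (CommRingCat.ofHom (algebraMap V K))) (geomPoint 𝔛₀ K).fromNormalization
      (Spec.map (CommRingCat.ofHom j) ≫ 𝔛₀.fromSpecStalk x) := by
    constructor
    rw [Scheme.Hom.toNormalization_fromNormalization, geomPoint,
      ← Scheme.SpecMap_stalkSpecializes_fromSpecStalk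
        ((genericPoint_spec 𝔛₀).specializes (trivial : x ∈ Set.univ)),
      ← Category.assoc, ← Category.assoc, ← Spec.map_comp, ← Spec.map_comp]
    rfl
  -- The normalization is universally closed over `𝔛₀`, so the valuative criterion supplies the
  -- center of `V`.
  have hcrit : ValuativeCriterion.Existence (geomPoint 𝔛₀ K).fromNormalization :=
    (show (ValuativeCriterion.Existence ⊓ @QuasiCompact) (geomPoint 𝔛₀ K).fromNormalization by
      rw [← UniversallyClosed.eq_valuativeCriterion]; infer_instance).1
  have := hcrit ⟨V, K, _, _, hsq⟩
  exact ⟨V, j, hloc, fun a => rfl, ⟨hsq.lift⟩⟩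

/-- Specialization of pairs from characteristic zero to characteristic `p`. -/
lemma exists_tendsto_cPoint {X : Scheme.{u}} {K : Type u} [Field K] [CharZero K]
    (V : ValuationSubring K) (g : Spec (.of V) ⟶ X) (p : ℕ) [Fact p.Prime]
    [CharP (IsLocalRing.ResidueField V) p] (h : Kˣ →* ℂˣ) (h1 : ∀ a ∈ V.unitGroup, h a = 1)
    (hlt : ∀ a : Kˣ, V.valuation (a : K) < 1 → ‖(h a : ℂ)‖ < 1) :
    ∃ (z : CPoint X) (w : Finset Kˣ × ℕ → CPoint X),
      z ∈ CPoint.torsionInjective X ∧ z ∈ CPoint.fibre X p ∧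
      (∀ i, w i ∈ CPoint.torsionFinite X ∧ w i ∈ CPoint.fibre X 0) ∧
      Tendsto w atTop (𝓝 z) := by
  obtain ⟨P, hP⟩ := exists_character_injOn_torsion_of_charP (IsLocalRing.ResidueField V) p
  obtain ⟨w, hw, hlim⟩ := exists_tendsto_character V p h h1 hlt P hP
  have hpt : (Spec.map (CommRingCat.ofHom (IsLocalRing.residue V)) ≫ g)
      (IsLocalRing.closedPoint (IsLocalRing.ResidueField V)) = g (IsLocalRing.closedPoint V) := by
    exact (Scheme.Hom.comp_apply _ _ _).trans <| congrArg g (IsLocalRing.comap_closedPoint (IsLocalRing.residue V))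
  refine ⟨CPoint.ofField (Spec.map (CommRingCat.ofHom (IsLocalRing.residue V)) ≫ g) P,
    fun i => CPoint.ofField (Spec.map (CommRingCat.ofHom V.subtype) ≫ g) (w i),
    CPoint.ofField_mem_torsionInjective _ _ hP, CPoint.ofField_mem_fibre _ _ _,
    fun i => ⟨CPoint.ofField_mem_torsionFinite _ _ (hw i), CPoint.ofField_mem_fibre _ _ _⟩, ?_⟩
  refine TopologicalSpace.tendsto_nhds_generateFrom_iff.2 ?_
  rintro _ ⟨U, f, W, hW, rfl⟩ ⟨hz, hzW⟩
  have hz' : (Spec.map (CommRingCat.ofHom (IsLocalRing.residue V)) ≫ g)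
      (IsLocalRing.closedPoint (IsLocalRing.ResidueField V)) ∈ U := hz
  have hU : g (IsLocalRing.closedPoint V) ∈ U := hpt ▸ hz'
  -- An open set containing the image of the closed point of `Spec V` contains the whole image, in
  -- particular that of the generic point.
  have hK : (Spec.map (CommRingCat.ofHom V.subtype) ≫ g) (IsLocalRing.closedPoint K) ∈ U := by
    have h' := (Scheme.preimage_eq_top_of_closedPoint_mem g hU).ge
      (Set.mem_univ (Spec.map (CommRingCat.ofHom V.subtype) (IsLocalRing.closedPoint K)))
    exact h'
  have hv := CPoint.value_ofField (Spec.map (CommRingCat.ofHom (IsLocalRing.residue V)) ≫ g) P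
    U hz' f
  rw [CPoint.germ_stalkClosedPointTo_comp g (IsLocalRing.residue V) U hU hz' f] at hv
  rw [hv] at hzW
  filter_upwards [hlim _ (hW.mem_nhds hzW)] with i hi
  refine ⟨hK, ?_⟩
  have hvi := CPoint.value_ofField (Spec.map (CommRingCat.ofHom V.subtype) ≫ g) (w i) U hK f
  rw [CPoint.germ_stalkClosedPointTo_comp g V.subtype U hU hK f] at hvi
  rw [hvi]
  exact hi

/-- For a normal scheme flat and of finite type over `ℤ` the canonical map is not open: points of
residue characteristic zero specialize to points of characteristic `p`. -/
lemma not_isHomeomorph_canonicalMap [IsAlgClosure 𝔛₀.functionField K]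
    (hnormal : ∀ x : 𝔛₀, IsIntegrallyClosed (𝔛₀.presheaf.stalk x))
    (hflat : Flat (specULiftZIsTerminal.from 𝔛₀))
    (hft : LocallyOfFiniteType (specULiftZIsTerminal.from 𝔛₀)) :
    ¬ IsHomeomorph (torsCondition 𝔛₀ K).canonicalMap := by
  obtain ⟨hchar, p, x, hp, hdvr, hpx⟩ := exists_discreteValuationRing_stalk hnormal hflat hft
  obtain ⟨V, j, hloc, hj, ⟨g⟩⟩ := exists_valuationSubring_center (K := K) x
  have : CharZero K := charZero_of_injective_algebraMap (algebraMap 𝔛₀.functionField K).injective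
  have : Algebra.IsAlgebraic 𝔛₀.functionField K := IsAlgClosure.isAlgebraic
  have : Fact p.Prime := ⟨hp⟩
  have : CharP (IsLocalRing.ResidueField V) p := by
    have h0 : (p : IsLocalRing.ResidueField V) = 0 := by
      rw [← map_natCast (IsLocalRing.residue V), ← map_natCast j, IsLocalRing.residue_eq_zero_iff,
        IsLocalRing.mem_maximalIdeal]
      exact fun h => hpx (isUnit_of_map_unit j _ h)
    obtain ⟨q, hq⟩ := CharP.exists (IsLocalRing.ResidueField V)
    have hqp := (CharP.cast_eq_zero_iff (IsLocalRing.ResidueField V) q p).1 h0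
    rcases (Nat.dvd_prime hp).1 hqp with rfl | rfl
    · exact absurd rfl (CharP.char_ne_one (IsLocalRing.ResidueField V) 1)
    · exact hq
  obtain ⟨h, h1, hlt⟩ := exists_contracting_character V j hj
  obtain ⟨z, w, hz, hzp, hw, hlim⟩ := exists_tendsto_cPoint V g p h h1 hlt
  intro hhom
  let E := torsCondition 𝔛₀ K
  have hzE : z ∈ E.carrier := CPoint.torsionInjective_subset_torsionFinite _ hz
  let π : E.carrier → E.Target := fun y => Suspension.mk 1 (GalQuot.mk y) ⟨1, one_pos⟩
  have hπ : Continuous π := by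
    refine continuous_quotient_mk'.comp (Continuous.prodMk ?_ continuous_const)
    refine Continuous.comp (g := Quotient.mk (frobSetoid _)) continuous_quotient_mk' ?_
    exact continuous_sigmaMk.comp GalQuot.isQuotientMap_mk.continuous
  let q : Nat.Primes := ⟨p, hp⟩
  -- The `p`-part is a summand of the source, so a homeomorphism would make its image open; that
  -- image contains the limit point.
  let O : Set E.Target := E.canonicalMap '' Set.range fun s => Sum.inr ⟨q, s⟩
  have hO : IsOpen O := hhom.isOpenMap _
    (isOpenMap_inr.comp isOpenMap_sigmaMk).isOpen_range
  have hzO : π ⟨z, hzE⟩ ∈ O :=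
    ⟨_, ⟨Quotient.mk _ (GalQuot.mk ⟨z, hzE, hz, hzp⟩, ⟨1, one_pos⟩), rfl⟩, rfl⟩
  have hlim' : Tendsto (fun i => (⟨w i, (hw i).1⟩ : E.carrier)) atTop (𝓝 ⟨z, hzE⟩) :=
    tendsto_subtype_rng.2 hlim
  have : (atTop : Filter (Finset Kˣ × ℕ)).NeBot := by
    rw [← prod_atTop_atTop_eq]
    infer_instance
  obtain ⟨i, hi⟩ := ((hπ.tendsto _).comp hlim' |>.eventually (hO.mem_nhds hzO)).exists
  obtain ⟨_, ⟨⟨P, u⟩, rfl⟩, hs⟩ := hi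
  obtain ⟨y, rfl⟩ := GalQuot.mk_surjective P
  obtain ⟨σ, k, l, hkl, -⟩ := E.suspension_mk_eq (a := 1) (b := 1) (v := ⟨1, one_pos⟩)
    (z := ⟨y.1, E.piece_subset _ y.2⟩) (w := ⟨w i, (hw i).1⟩) (u := u) hs
  -- An approximating pair in this open set would have residue characteristic both `p` and `0`.
  exact hp.ne_zero (CPoint.smul_eq_smul_char hkl y.2.2.2 ((gal_smul_mem_fibre_iff σ).2 (hw i).2))

end Specialization

end ArithDyn

open AlgebraicGeometry ArithDyn

universe u

theorem theorem4p4 (𝔛₀ : Scheme.{u}) [AlgebraicGeometry.IsIntegral 𝔛₀]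
    (hnormal : ∀ x : 𝔛₀, IsIntegrallyClosed (𝔛₀.presheaf.stalk x))
    (K : Type u) [Field K] [Algebra 𝔛₀.functionField K] [IsAlgClosure 𝔛₀.functionField K] :
    -- the canonical map to `𝔛₀(ℂ)ˇ ×_{ℚ^{>0}} ℝ^{>0}` for the torsion condition
    ((∀ p : Nat.Primes, IsHomeomorph ((torsCondition 𝔛₀ K).frobPiece p)) ∧
      Continuous (torsCondition 𝔛₀ K).canonicalMap ∧
      Function.Bijective (torsCondition 𝔛₀ K).canonicalMap ∧
      ∀ (t : ℝ) (s : (torsCondition 𝔛₀ K).Source),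
        (torsCondition 𝔛₀ K).canonicalMap ((torsCondition 𝔛₀ K).sourceFlow t s) =
          Suspension.flow t ((torsCondition 𝔛₀ K).canonicalMap s)) ∧
    -- the same after imposing an admissible condition
    (∀ E : CharCondition 𝔛₀ K, E.IsAdmissible →
      (∀ p : Nat.Primes, IsHomeomorph (E.frobPiece p)) ∧
      Continuous E.canonicalMap ∧
      Function.Bijective E.canonicalMap ∧
      ∀ (t : ℝ) (s : E.Source),
        E.canonicalMap (E.sourceFlow t s) = Suspension.flow t (E.canonicalMap s)) ∧
    -- the map is not a homeomorphism
    (Flat (specULiftZIsTerminal.from 𝔛₀) → LocallyOfFiniteType (specULiftZIsTerminal.from 𝔛₀) →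
      QuasiCompact (specULiftZIsTerminal.from 𝔛₀) →
      ¬ IsHomeomorph (torsCondition 𝔛₀ K).canonicalMap) := by
  have : IsAlgClosed K := IsAlgClosure.isAlgClosed 𝔛₀.functionField
  have main (E : CharCondition 𝔛₀ K) (hE : E.IsAdmissible) :=
    And.intro E.isHomeomorph_frobPiece (And.intro E.continuous_canonicalMap
      (And.intro (E.canonicalMap_bijective hE) E.canonicalMap_sourceFlow))
  exact ⟨main _ subset_rfl, main,
    fun hflat hft _ => not_isHomeomorph_canonicalMap hnormal hflat hft⟩
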